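/- **Proposition.** Let $X$ be a connected smooth oriented Riemannian $4$-manifold and let $c:X\to X$ be a smooth isometric orientation preserving involution; let $P$ be the $\mathrm{SO}(4)$-bundle of oriented orthonormal frames and $dc:P\to P$ the map induced by the differential of $c$. Write $\mathrm{Spin}^c(4)=(\mathrm{Spin}(4)\times \mathrm U(1))/\{\pm1\}$, with complex conjugation $\overline{[a,z]}=[a,\bar z]$ and determinant $\det[a,z]=z^2$. Let $\mathfrak s$ be a $\mathrm{Spin}^c$ structure on $X$, i.e. a principal $\mathrm{Spin}^c(4)$-bundle over $X$ with a map $\mathfrak s\to P$ over $X$ that is equivariant for $\mathrm{Spin}^c(4)\to \mathrm{SO}(4)$, and let $Q=\mathfrak s\times_{\det}\mathrm U(1)$ be its determinant bundle. (Principal bundles and maps between them are continuous.) Suppose that $Q$ is $c$-real, and let $c_Q:Q\to Q$ be a real structure on it: an involution covering $c$ with $c_Q(qz)=c_Q(q)\bar z$ for $z\in\mathrm U(1)$. For an open set $U\subseteq X$, an *antilinear lift of $dc$ over $U$* is a continuous map $f:\mathfrak s|_U\to\mathfrak s$ that covers $dc$ on $P$, induces $c_Q$ on $Q$, and satisfies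 $f(pk)=f(p)\bar k$ for all $k\in\mathrm{Spin}^c(4)$; let $\mathcal C_{\mathfrak s}$ be the set of those over $U=X$. 1. There are an open cover $(U_\alpha)$ of $X$ and antilinear lifts $f_\alpha$ of $dc$ over $U_\alpha$ that differ on the overlaps by locally constant signs, $f_\alpha=\mu_{\alpha\beta}f_\beta$ with $\mu_{\alpha\beta}:U_\alpha\cap U_\beta\to\{\pm1\}$; the class $\mu=[\{\mu_{\alpha\beta}\}]\in H^1(X,\mathbb Z/2)$ (Čech cohomology) does not depend on the choices of $(U_\alpha)$ and $(f_\alpha)$. 2. $\mu=0$ if and only if $c^*\mathfrak s=-\mathfrak s$. Here $-\mathfrak s$ is the space $\mathfrak s$ with its map to $P$ and with the action of $\mathrm{Spin}^c(4)$ composed with complex conjugation, its determinant bundle is $-Q$ (the space $Q$ with the conjugate action of $\mathrm U(1)$), and $c^*\mathfrak s=-\mathfrak s$ means that there is an isomorphism of $\mathrm{Spin}^c$ structures $-\mathfrak s\to c^*\mathfrak s$ inducing on the determinant bundles the isomorphism $-Q\to c^*Q$ given by $c_Q$. 3. If $\mu=0$, then $\mathcal C_{\mathfrak s}\neq\emptyset$,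 and there is a unique sign $\epsilon(\mathfrak s)\in\{\pm1\}$ such that $c_{\mathfrak s}^2=\epsilon(\mathfrak s)\,\mathrm{Id}$ for every $c_{\mathfrak s}\in\mathcal C_{\mathfrak s}$. -/

import Mathlib

open scoped Manifold ContDiff Quaternion Topology

universe u v w

noncomputable section

/-- `Sp(1)`, the group of unit quaternions. -/
abbrev Sp1 : Type := unitary ℍ[ℝ]

/-- The basis `1, i, j, k` of `ℍ`. -/
def Spinc4.quatBasis : Module.Basis (Fin 4) ℝ ℍ[ℝ] := QuaternionAlgebra.basisOneIJK (-1) 0 (-1)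

/-- The real endomorphism `x ↦ p x q⁻¹` of `ℍ` (note that `q⁻¹ = star q`). -/
def Spinc4.rotEnd : Sp1 × Sp1 →* Module.End ℝ ℍ[ℝ] where
  toFun a := LinearMap.mulLeft ℝ (a.1 : ℍ[ℝ]) ∘ₗ LinearMap.mulRight ℝ (star (a.2 : ℍ[ℝ]))
  map_one' := by ext x <;> simp
  map_mul' a b := by
    refine LinearMap.ext fun x => ?_
    simp [mul_assoc]

theorem Spinc4.toMatrix_apply_quat (f : Module.End ℝ ℍ[ℝ]) :
    LinearMap.toMatrix quatBasis quatBasis f = Matrix.of fun i j =>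
      ![(f (quatBasis j)).re, (f (quatBasis j)).imI, (f (quatBasis j)).imJ,
        (f (quatBasis j)).imK] i := by
  ext i j
  rw [LinearMap.toMatrix_apply]
  rfl

theorem Spinc4.normSq_eq (p : Sp1) : (p : ℍ[ℝ]).re ^ 2 + (p : ℍ[ℝ]).imI ^ 2
    + (p : ℍ[ℝ]).imJ ^ 2 + (p : ℍ[ℝ]).imK ^ 2 = 1 := by
  have h := (Unitary.mem_iff.1 p.2).2
  rw [Quaternion.self_mul_star, Quaternion.normSq_def'] at h
  rw [← Quaternion.coe_one, Quaternion.coe_inj] at h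
  exact h

theorem Spinc4.quatBasis_apply (j : Fin 4) : quatBasis j =
    (![⟨1, 0, 0, 0⟩, ⟨0, 1, 0, 0⟩, ⟨0, 0, 1, 0⟩, ⟨0, 0, 0, 1⟩] : Fin 4 → ℍ[ℝ]) j := by
  apply quatBasis.repr.injective
  rw [Module.Basis.repr_self]
  ext i
  have : ∀ q : ℍ[ℝ], quatBasis.repr q i = ![q.re, q.imI, q.imJ, q.imK] i := fun q => rfl
  rw [this]
  fin_cases i <;> fin_cases j <;> simp

theorem Spinc4.left_mem (p : Sp1) :
    LinearMap.toMatrix quatBasis quatBasis (LinearMap.mulLeft ℝ (p : ℍ[ℝ])) ∈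
      Matrix.specialOrthogonalGroup (Fin 4) ℝ := by
  have h := normSq_eq p
  have e : LinearMap.toMatrix quatBasis quatBasis (LinearMap.mulLeft ℝ (p : ℍ[ℝ])) =
     !![(p : ℍ[ℝ]).re, -(p : ℍ[ℝ]).imI, -(p : ℍ[ℝ]).imJ, -(p : ℍ[ℝ]).imK;
        (p : ℍ[ℝ]).imI, (p : ℍ[ℝ]).re, -(p : ℍ[ℝ]).imK, (p : ℍ[ℝ]).imJ;
        (p : ℍ[ℝ]).imJ, (p : ℍ[ℝ]).imK, (p : ℍ[ℝ]).re, -(p : ℍ[ℝ]).imI;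
        (p : ℍ[ℝ]).imK, -(p : ℍ[ℝ]).imJ, (p : ℍ[ℝ]).imI, (p : ℍ[ℝ]).re] := by
    rw [toMatrix_apply_quat]
    ext i j
    fin_cases i <;> fin_cases j <;> simp [quatBasis_apply]
  rw [e]
  generalize (p : ℍ[ℝ]).re = a at *
  generalize (p : ℍ[ℝ]).imI = b at *
  generalize (p : ℍ[ℝ]).imJ = c at *
  generalize (p : ℍ[ℝ]).imK = d at *
  rw [Matrix.mem_specialOrthogonalGroup_iff, Matrix.mem_orthogonalGroup_iff]
  constructor
  · ext i j
    fin_cases i <;> fin_cases j <;> simp [Matrix.mul_apply, Fin.sum_univ_four] <;> linarith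
  · have : (a ^ 2 + b ^ 2 + c ^ 2 + d ^ 2) ^ 2 = 1 := by rw [h]; norm_num
    rw [← this]
    simp [Matrix.det_succ_row_zero, Fin.sum_univ_succ, Fin.succAbove]
    ring

theorem Spinc4.right_mem (p : Sp1) :
    LinearMap.toMatrix quatBasis quatBasis (LinearMap.mulRight ℝ (star (p : ℍ[ℝ]))) ∈
      Matrix.specialOrthogonalGroup (Fin 4) ℝ := by
  have h := normSq_eq p
  have e : LinearMap.toMatrix quatBasis quatBasis (LinearMap.mulRight ℝ (star (p : ℍ[ℝ]))) =
     !![(p : ℍ[ℝ]).re, (p : ℍ[ℝ]).imI, (p : ℍ[ℝ]).imJ, (p : ℍ[ℝ]).imK;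
        -(p : ℍ[ℝ]).imI, (p : ℍ[ℝ]).re, -(p : ℍ[ℝ]).imK, (p : ℍ[ℝ]).imJ;
        -(p : ℍ[ℝ]).imJ, (p : ℍ[ℝ]).imK, (p : ℍ[ℝ]).re, -(p : ℍ[ℝ]).imI;
        -(p : ℍ[ℝ]).imK, -(p : ℍ[ℝ]).imJ, (p : ℍ[ℝ]).imI, (p : ℍ[ℝ]).re] := by
    rw [toMatrix_apply_quat]
    ext i j
    fin_cases i <;> fin_cases j <;> simp [quatBasis_apply]
  rw [e]
  generalize (p : ℍ[ℝ]).re = a at *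
  generalize (p : ℍ[ℝ]).imI = b at *
  generalize (p : ℍ[ℝ]).imJ = c at *
  generalize (p : ℍ[ℝ]).imK = d at *
  rw [Matrix.mem_specialOrthogonalGroup_iff, Matrix.mem_orthogonalGroup_iff]
  constructor
  · ext i j
    fin_cases i <;> fin_cases j <;> simp [Matrix.mul_apply, Fin.sum_univ_four] <;> linarith
  · have : (a ^ 2 + b ^ 2 + c ^ 2 + d ^ 2) ^ 2 = 1 := by rw [h]; norm_num
    rw [← this]
    simp [Matrix.det_succ_row_zero, Fin.sum_univ_succ, Fin.succAbove]
    ring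

/-- The homomorphism `Sp(1) × Sp(1) → SO(4)`: the matrix, in the basis `1, i, j, k` of `ℍ`,
of `x ↦ p x q⁻¹`. -/
def Spinc4.rot : Sp1 × Sp1 →* Matrix.specialOrthogonalGroup (Fin 4) ℝ :=
  ((LinearMap.toMatrixAlgEquiv quatBasis : Module.End ℝ ℍ[ℝ] →* Matrix (Fin 4) (Fin 4) ℝ).comp
    rotEnd).codRestrict (Matrix.specialOrthogonalGroup (Fin 4) ℝ) (by
      intro a
      have := mul_mem (left_mem a.1) (right_mem a.2)
      rw [← LinearMap.toMatrix_comp] at this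
      exact this)

/-- The subgroup `{(1, 1, 1), (-1, -1, -1)}`. -/
def Spinc4.signSubgroup : Subgroup ((Sp1 × Sp1) × Circle) :=
  Subgroup.zpowers ((-1, -1), -1)

instance : Spinc4.signSubgroup.Normal where
  conj_mem n hn g := by
    obtain ⟨k, rfl⟩ := Subgroup.mem_zpowers_iff.1 hn
    have h : Commute g ((((-1, -1), -1) : (Sp1 × Sp1) × Circle)) := by
      refine Prod.ext (Prod.ext ?_ ?_) ?_ <;> simp
    rw [(h.zpow_right k).eq, mul_inv_cancel_right]
    exact hn

/-- `Spin^c(4) = (Spin(4) × U(1)) / {± 1}`, where `Spin(4) = Sp(1) × Sp(1)`. -/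
abbrev Spinc4 : Type := ((Sp1 × Sp1) × Circle) ⧸ Spinc4.signSubgroup

namespace Spinc4

theorem signSubgroup_le_ker {H : Type*} [Group H] (f : (Sp1 × Sp1) × Circle →* H)
    (h : f ((-1, -1), -1) = 1) : signSubgroup ≤ f.ker := by
  rw [signSubgroup, Subgroup.zpowers_le]
  exact h

/-- The projection `Spin^c(4) → SO(4)`, `[p, q, z] ↦ (x ↦ p x q⁻¹)`. -/
def toSO : Spinc4 →* Matrix.specialOrthogonalGroup (Fin 4) ℝ :=
  QuotientGroup.lift signSubgroup (rot.comp (MonoidHom.fst _ _))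
    (signSubgroup_le_ker _ (by
      apply Subtype.ext
      change LinearMap.toMatrixAlgEquiv quatBasis (rotEnd (-1, -1)) = 1
      have : rotEnd (-1, -1) = 1 := by
        refine LinearMap.ext fun x => ?_
        simp [rotEnd, Unitary.coe_neg]
      rw [this, map_one]))

/-- The determinant character `Spin^c(4) → U(1)`, `[p, q, z] ↦ z ^ 2`. -/
def det : Spinc4 →* Circle :=
  QuotientGroup.lift signSubgroup ((powMonoidHom 2).comp (MonoidHom.snd _ _))
    (signSubgroup_le_ker _ (by simp))

/-- Complex conjugation on `Spin^c(4)`, `[p, q, z] ↦ [p, q, z̄]`. -/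
def conj : Spinc4 →* Spinc4 :=
  QuotientGroup.map signSubgroup signSubgroup
    ((MonoidHom.id (Sp1 × Sp1)).prodMap (invMonoidHom : Circle →* Circle)) (by
      rw [signSubgroup, Subgroup.zpowers_le, Subgroup.mem_comap]
      have : ((MonoidHom.id (Sp1 × Sp1)).prodMap (invMonoidHom : Circle →* Circle))
          ((-1, -1), -1) = ((-1, -1), -1) := by
        refine Prod.ext rfl ?_
        simp
      rw [this]
      exact Subgroup.mem_zpowers _)

/-- The elements `± 1 = [1, 1, ± 1]` of `Spin^c(4)`, indexed by `ℤ/2`. -/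
def sign (n : ZMod 2) : Spinc4 := if n = 0 then 1 else QuotientGroup.mk ((1, 1), -1)

theorem conj_conj (k : Spinc4) : conj (conj k) = k := by
  induction k using QuotientGroup.induction_on with
  | H z =>
    simp only [conj, QuotientGroup.map_mk, MonoidHom.prodMap]
    congr 1
    simp

theorem toSO_conj (k : Spinc4) : toSO (conj k) = toSO k := by
  induction k using QuotientGroup.induction_on with
  | H z => rfl

theorem continuous_conj : Continuous conj :=
  continuous_quot_lift _ (QuotientGroup.continuous_mk.comp (by
    change Continuous fun z : (Sp1 × Sp1) × Circle => (z.1, z.2⁻¹)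
    fun_prop))

theorem continuous_det : Continuous det :=
  continuous_quot_lift _ (by
    change Continuous fun z : (Sp1 × Sp1) × Circle => z.2 ^ 2
    fun_prop)

end Spinc4

/-- A (topological) principal `G`-bundle over `X`: a space with a right action of `G` over `X`
which is locally, over `X`, equivariantly homeomorphic to `U × G`. -/
structure PrincipalBundle (G : Type w) [Group G] [TopologicalSpace G]
    (X : Type u) [TopologicalSpace X] where
  total : Type v
  [top : TopologicalSpace total]
  proj : total → X
  continuous_proj : Continuous proj
  act : total → G → total
  act_one : ∀ p, act p 1 = p
  act_mul : ∀ p k l, act p (k * l) = act (act p k) l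
  proj_act : ∀ p k, proj (act p k) = proj p
  locally_trivial : ∀ x : X, ∃ U : Set X, IsOpen U ∧ x ∈ U ∧ ∃ φ : U × G ≃ₜ proj ⁻¹' U,
    (∀ a, proj (φ a) = a.1) ∧ ∀ y k l, (φ (y, k * l) : total) = act (φ (y, k)) l

namespace PrincipalBundle

attribute [instance] PrincipalBundle.top

variable {G : Type w} [Group G] [TopologicalSpace G] {X : Type u} [TopologicalSpace X]

/-- The same bundle, with the action twisted by an involutive automorphism of the group. -/
def twist (E : PrincipalBundle.{u, v, w} G X) (σ : G →* G) (hσ : Continuous σ)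
    (hσσ : ∀ k, σ (σ k) = k) : PrincipalBundle.{u, v, w} G X where
  total := E.total
  proj := E.proj
  continuous_proj := E.continuous_proj
  act p k := E.act p (σ k)
  act_one p := by rw [map_one, E.act_one]
  act_mul p k l := by rw [map_mul, E.act_mul]
  proj_act p k := E.proj_act p _
  locally_trivial x := by
    obtain ⟨U, hU, hx, φ, h1, h2⟩ := E.locally_trivial x
    let s : G ≃ₜ G :=
      { toFun := σ, invFun := σ, left_inv := hσσ, right_inv := hσσ,
        continuous_toFun := hσ, continuous_invFun := hσ }
    refine ⟨U, hU, hx, ((Homeomorph.refl U).prodCongr s).trans φ, fun a => h1 _, ?_⟩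
    intro y k l
    change (φ (y, σ (k * l)) : E.total) = E.act (φ (y, σ k)) (σ l)
    rw [map_mul, h2]

/-- The pullback of a principal bundle by a continuous map. -/
def pullback {Y : Type u} [TopologicalSpace Y] (E : PrincipalBundle.{u, v, w} G X) (f : Y → X)
    (hf : Continuous f) : PrincipalBundle.{u, max u v, w} G Y where
  total := {a : Y × E.total // E.proj a.2 = f a.1}
  proj a := a.1.1
  continuous_proj := by fun_prop
  act a k := ⟨(a.1.1, E.act a.1.2 k), by rw [E.proj_act]; exact a.2⟩
  act_one a := by simp only [E.act_one]
  act_mul a k l := by simp only [E.act_mul]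
  proj_act a k := rfl
  locally_trivial y := by
    obtain ⟨U, hU, hx, φ, h1, h2⟩ := E.locally_trivial (f y)
    refine ⟨f ⁻¹' U, hU.preimage hf, hx, ?_⟩
    have hc : Continuous fun a : (f ⁻¹' U) × G => (φ (⟨f a.1, a.1.2⟩, a.2) : E.total) := by
      fun_prop
    let A : (fun a : {a : Y × E.total // E.proj a.2 = f a.1} => a.1.1) ⁻¹' (f ⁻¹' U) →
        E.proj ⁻¹' U := fun a => ⟨a.1.1.2, by
          have h := a.2
          have h' := a.1.2
          simp only [Set.mem_preimage] at h ⊢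
          rw [h']
          exact h⟩
    have hA : Continuous A := by
      apply Continuous.subtype_mk
      fun_prop
    refine ⟨{ toFun := fun a => ⟨⟨(a.1, φ (⟨f a.1, a.1.2⟩, a.2)), h1 _⟩, a.1.2⟩
              invFun := fun a => (⟨a.1.1.1, a.2⟩, (φ.symm (A a)).2)
              left_inv := ?_
              right_inv := ?_
              continuous_toFun := ?_
              continuous_invFun := ?_ }, ?_, ?_⟩
    · rintro ⟨z, k⟩
      simp [A]
    · rintro ⟨⟨⟨z, p⟩, hp⟩, hz⟩
      apply Subtype.ext
      apply Subtype.ext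
      refine Prod.ext rfl ?_
      change (φ (⟨f z, hz⟩, (φ.symm ⟨p, _⟩).2) : E.total) = p
      have e : (φ.symm ⟨p, by change E.proj p ∈ U; rw [hp]; exact hz⟩).1 = ⟨f z, hz⟩ := by
        apply Subtype.ext
        rw [← h1, Homeomorph.apply_symm_apply]
        exact hp
      rw [← e]
      simp
    · refine Continuous.subtype_mk (Continuous.subtype_mk ?_ _) _
      fun_prop
    · refine Continuous.prodMk (Continuous.subtype_mk (by fun_prop) _) ?_
      fun_prop
    · intro a
      rfl
    · intro z k l
      apply Subtype.ext
      refine Prod.ext rfl ?_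
      exact h2 _ _ _

section Extension

variable {H : Type*} [CommGroup H] [TopologicalSpace H] [IsTopologicalGroup H]

/-- The equivalence relation `(p · k, z) ~ (p, ψ(k) z)` on `E × H`. -/
def extendSetoid (E : PrincipalBundle.{u, v, w} G X) (ψ : G →* H) : Setoid (E.total × H) where
  r a b := ∃ k : G, a.1 = E.act b.1 k ∧ b.2 = ψ k * a.2
  iseqv :=
    { refl := fun a => ⟨1, by rw [E.act_one], by rw [map_one, one_mul]⟩
      symm := by
        rintro a b ⟨k, h1, h2⟩
        refine ⟨k⁻¹, ?_, ?_⟩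
        · rw [h1, ← E.act_mul, mul_inv_cancel, E.act_one]
        · rw [h2, map_inv, inv_mul_cancel_left]
      trans := by
        rintro a b c ⟨k, h1, h2⟩ ⟨l, h3, h4⟩
        refine ⟨l * k, ?_, ?_⟩
        · rw [h1, h3, E.act_mul]
        · rw [h4, h2, map_mul, mul_assoc] }

theorem exists_extend_triv (E : PrincipalBundle.{u, v, w} G X) {U : Set X}
    (φ : U × G ≃ₜ E.proj ⁻¹' U) (h1 : ∀ a, E.proj (φ a) = a.1)
    (p : E.total) (hp : E.proj p ∈ U) :
    φ (⟨E.proj p, hp⟩, (φ.symm ⟨p, hp⟩).2) = ⟨p, hp⟩ := by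
  have e : (φ.symm ⟨p, hp⟩).1 = ⟨E.proj p, hp⟩ := by
    apply Subtype.ext
    rw [← h1, Homeomorph.apply_symm_apply]
  rw [← e]
  simp

/-- The principal `H`-bundle `E ×_ψ H` associated with a principal `G`-bundle `E` and a
continuous homomorphism `ψ` from `G` to a commutative group `H`. -/
def extend (E : PrincipalBundle.{u, v, w} G X) (ψ : G →* H) (hψ : Continuous ψ) :
    PrincipalBundle H X where
  total := Quotient (E.extendSetoid ψ)
  proj := Quotient.lift (fun a => E.proj a.1) (by
    rintro a b ⟨k, h1, -⟩
    simp only [h1, E.proj_act])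
  continuous_proj := Continuous.quotient_lift (E.continuous_proj.comp continuous_fst) _
  act q z := Quotient.map (fun a : E.total × H => (a.1, a.2 * z)) (by
    rintro a b ⟨k, h1, h2⟩
    exact ⟨k, h1, by simp only [h2, mul_assoc]⟩) q
  act_one := by
    rintro ⟨p, z⟩
    exact congrArg (Quotient.mk _) (by simp)
  act_mul := by
    rintro ⟨p, z⟩ k l
    exact congrArg (Quotient.mk _) (by simp [mul_assoc])
  proj_act := by
    rintro ⟨p, z⟩ k
    rfl
  locally_trivial x := by
    obtain ⟨U, hU, hx, φ, h1, h2⟩ := E.locally_trivial x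
    refine ⟨U, hU, hx, ?_⟩
    let π : Quotient (E.extendSetoid ψ) → X := Quotient.lift (fun a => E.proj a.1) (by
      rintro a b ⟨k, h1, -⟩
      simp only [h1, E.proj_act])
    have hπ : Continuous π :=
      Continuous.quotient_lift (E.continuous_proj.comp continuous_fst) _
    let T : π ⁻¹' U → H := fun q => Quotient.hrecOn
      (motive := fun q : Quotient (E.extendSetoid ψ) => q ∈ π ⁻¹' U → H) q.1
      (fun a ha => ψ (φ.symm ⟨a.1, ha⟩).2 * a.2) (by
        rintro a b ⟨k, e1, e2⟩
        apply Function.hfunext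
        · have : E.proj a.1 = E.proj b.1 := by rw [e1, E.proj_act]
          exact congrArg (fun t => t ∈ U) this
        · intro ha hb _
          apply heq_of_eq
          have : φ.symm ⟨a.1, ha⟩ = (⟨E.proj b.1, hb⟩, (φ.symm ⟨b.1, hb⟩).2 * k) := by
            rw [Homeomorph.symm_apply_eq]
            apply Subtype.ext
            rw [h2, E.exists_extend_triv φ h1 b.1 hb, ← e1]
          rw [this, e2, map_mul, mul_assoc]) q.2
    have hT : Continuous T := by
      have hq : Topology.IsQuotientMap (Quotient.mk (E.extendSetoid ψ)) := isQuotientMap_quotient_mk'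
      have hq' := hq.restrictPreimage_isOpen (hU.preimage hπ)
      rw [hq'.continuous_iff]
      change Continuous fun a : (Quotient.mk (E.extendSetoid ψ)) ⁻¹' (π ⁻¹' U) =>
        ψ (φ.symm ⟨a.1.1, a.2⟩).2 * a.1.2
      refine Continuous.mul (hψ.comp (continuous_snd.comp (φ.symm.continuous.comp ?_)))
        (by fun_prop)
      exact Continuous.subtype_mk (by fun_prop) _
    refine ⟨{ toFun := fun a => ⟨Quotient.mk _ ((φ (a.1, 1) : E.total), a.2), by
                change E.proj (φ (a.1, 1)) ∈ U
                rw [h1]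
                exact a.1.2⟩
              invFun := fun q => (⟨π q.1, q.2⟩, T q)
              left_inv := ?_
              right_inv := ?_
              continuous_toFun := ?_
              continuous_invFun := ?_ }, ?_, ?_⟩
    · rintro ⟨y, z⟩
      refine Prod.ext (Subtype.ext (h1 _)) ?_
      change ψ (φ.symm ⟨(φ (y, 1) : E.total), _⟩).2 * z = z
      have : φ.symm ⟨(φ (y, 1) : E.total), (φ (y, 1)).2⟩ = (y, 1) := φ.symm_apply_apply _
      rw [this, map_one, one_mul]
    · rintro ⟨⟨p, z⟩, hp⟩
      apply Subtype.ext
      apply Quotient.sound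
      refine ⟨(φ.symm ⟨p, hp⟩).2⁻¹, ?_, ?_⟩
      · change (φ (⟨E.proj p, hp⟩, 1) : E.total) = E.act p _
        have e := congrArg (fun t : E.proj ⁻¹' U => E.act t (φ.symm ⟨p, hp⟩).2⁻¹)
          (E.exists_extend_triv φ h1 p hp)
        rw [← e]
        rw [← h2, mul_inv_cancel]
      · change z = ψ (φ.symm ⟨p, hp⟩).2⁻¹ * (ψ (φ.symm ⟨p, hp⟩).2 * z)
        rw [map_inv, inv_mul_cancel_left]
    · refine Continuous.subtype_mk (continuous_quotient_mk'.comp ?_) _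
      fun_prop
    · exact Continuous.prodMk (Continuous.subtype_mk (hπ.comp continuous_subtype_val) _) hT
    · intro a
      exact h1 _
    · intro y k l
      rfl

/-- The canonical map `E → E ×_ψ H`, `p ↦ [p, 1]`. -/
def toExtend (E : PrincipalBundle.{u, v, w} G X) (ψ : G →* H) (hψ : Continuous ψ)
    (p : E.total) : (E.extend ψ hψ).total :=
  Quotient.mk (E.extendSetoid ψ) (p, 1)

end Extension

end PrincipalBundle

section Geometry

variable (X : Type u) [TopologicalSpace X] [ChartedSpace (EuclideanSpace ℝ (Fin 4)) X]
  [IsManifold (𝓡 4) ∞ X]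

/-- Smooth Riemannian metrics on a 4-manifold. -/
abbrev RiemannianMetric4 : Type u :=
  Bundle.ContMDiffRiemannianMetric (𝓡 4) ∞ (EuclideanSpace ℝ (Fin 4))
    (fun x : X => TangentSpace (𝓡 4) x)

/-- An orientation of a 4-manifold: an orientation of every tangent space such that, locally,
there are continuous positively oriented frames. -/
structure Orientation4 where
  at_ : ∀ x : X, Orientation ℝ (TangentSpace (𝓡 4) x) (Fin 4)
  locally_constant : ∀ x₀ : X, ∃ U : Set X, IsOpen U ∧ x₀ ∈ U ∧
    ∃ b : ∀ x : X, Module.Basis (Fin 4) ℝ (TangentSpace (𝓡 4) x),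
      (∀ i, ContinuousOn (fun x => (⟨x, b x i⟩ : TangentBundle (𝓡 4) X)) U) ∧
      ∀ x ∈ U, (b x).orientation = at_ x

variable {X}

/-- The total space `P` of the bundle of oriented orthonormal frames. -/
structure OrthoFrame (g : RiemannianMetric4 X) (o : Orientation4 X) where
  base : X
  basis : Module.Basis (Fin 4) ℝ (TangentSpace (𝓡 4) base)
  orthonormal : ∀ i j, g.inner base (basis i) (basis j) = if i = j then 1 else 0
  oriented : basis.orientation = o.at_ base

namespace OrthoFrame

variable {g : RiemannianMetric4 X} {o : Orientation4 X}

/-- The vectors of a frame, as points of the tangent bundle. -/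
def vectors (e : OrthoFrame g o) (i : Fin 4) : TangentBundle (𝓡 4) X := ⟨e.base, e.basis i⟩

/-- `P` carries the topology of a subspace of `TX × TX × TX × TX`. -/
instance : TopologicalSpace (OrthoFrame g o) := TopologicalSpace.induced vectors inferInstance

/-- The right action of `SO(4)` on `P`: `(e · A)_j = ∑ i, A_ij e_i`. -/
def act (e : OrthoFrame g o) (A : Matrix.specialOrthogonalGroup (Fin 4) ℝ) : OrthoFrame g o where
  base := e.base
  basis := e.basis.map (Matrix.toLinearEquiv e.basis (A : Matrix (Fin 4) (Fin 4) ℝ)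
    (by rw [(Matrix.mem_specialOrthogonalGroup_iff.1 A.2).2]; exact isUnit_one))
  orthonormal i j := by
    have h := (Matrix.mem_orthogonalGroup_iff' (Fin 4) ℝ).1 (Matrix.mem_specialOrthogonalGroup_iff.1 A.2).1
    have h' := congrFun (congrFun h i) j
    rw [Matrix.mul_apply, Matrix.one_apply] at h'
    rw [← h']
    change g.inner e.base (Matrix.toLin e.basis e.basis (A : Matrix (Fin 4) (Fin 4) ℝ) (e.basis i))
      (Matrix.toLin e.basis e.basis (A : Matrix (Fin 4) (Fin 4) ℝ) (e.basis j)) = _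
    rw [Matrix.toLin_self, Matrix.toLin_self]
    simp [e.orthonormal, mul_comm]
  oriented := by
    have : FiniteDimensional ℝ (TangentSpace (𝓡 4) e.base) := e.basis.finiteDimensional_of_finite
    rw [Module.Basis.orientation_map, ← e.oriented,
      Orientation.map_eq_iff_det_pos _ _ (by simp [Module.finrank_eq_card_basis e.basis])]
    change 0 < LinearMap.det (Matrix.toLin e.basis e.basis (A : Matrix (Fin 4) (Fin 4) ℝ))
    rw [LinearMap.det_toLin, (Matrix.mem_specialOrthogonalGroup_iff.1 A.2).2]
    exact one_pos

theorem act_basis (e : OrthoFrame g o) (A : Matrix.specialOrthogonalGroup (Fin 4) ℝ) (j : Fin 4) :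
    (e.act A).basis j = ∑ i, (A : Matrix (Fin 4) (Fin 4) ℝ) i j • e.basis i :=
  Matrix.toLin_self e.basis e.basis (A : Matrix (Fin 4) (Fin 4) ℝ) j

end OrthoFrame

/-- A smooth involution of `X` which is isometric and preserves the orientation. -/
structure IsometricInvolution (g : RiemannianMetric4 X) (o : Orientation4 X) where
  toDiffeo : X ≃ₘ^∞⟮𝓡 4, 𝓡 4⟯ X
  involutive : ∀ x, toDiffeo (toDiffeo x) = x
  isometric : ∀ x (v w : TangentSpace (𝓡 4) x),
    g.inner (toDiffeo x) (mfderiv (𝓡 4) (𝓡 4) toDiffeo x v) (mfderiv (𝓡 4) (𝓡 4) toDiffeo x w) =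
      g.inner x v w
  orientation_preserving : ∀ x, Orientation.map (Fin 4)
    (toDiffeo.mfderivToContinuousLinearEquiv (by simp) x).toLinearEquiv (o.at_ x) =
      o.at_ (toDiffeo x)

namespace IsometricInvolution

variable {g : RiemannianMetric4 X} {o : Orientation4 X}

instance : CoeFun (IsometricInvolution g o) fun _ => X → X := ⟨fun c => c.toDiffeo⟩

theorem continuous (c : IsometricInvolution g o) : Continuous c := c.toDiffeo.continuous

/-- The map `dc : P → P` induced by the differential of `c`. -/
def frameMap (c : IsometricInvolution g o) (e : OrthoFrame g o) : OrthoFrame g o where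
  base := c e.base
  basis := e.basis.map (c.toDiffeo.mfderivToContinuousLinearEquiv (by simp) e.base).toLinearEquiv
  orthonormal i j := by
    rw [← e.orthonormal i j]
    exact c.isometric e.base (e.basis i) (e.basis j)
  oriented := by
    rw [Module.Basis.orientation_map, e.oriented, c.orientation_preserving]

theorem continuous_frameMap (c : IsometricInvolution g o) : Continuous c.frameMap := by
  rw [continuous_induced_rng]
  refine continuous_pi fun i => ?_
  have h : Continuous (tangentMap (𝓡 4) (𝓡 4) c.toDiffeo) :=
    c.toDiffeo.contMDiff.continuous_tangentMap (by simp)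
  have h' : Continuous (OrthoFrame.vectors : OrthoFrame g o → _) := continuous_induced_dom
  exact h.comp ((continuous_apply i).comp h')

theorem frameMap_act (c : IsometricInvolution g o) (e : OrthoFrame g o)
    (A : Matrix.specialOrthogonalGroup (Fin 4) ℝ) :
    c.frameMap (e.act A) = (c.frameMap e).act A := by
  have : ∀ (b b' : Module.Basis (Fin 4) ℝ (TangentSpace (𝓡 4) (c e.base))) h1 h2 h3 h4, b = b' →
      (⟨c e.base, b, h1, h2⟩ : OrthoFrame g o) = ⟨c e.base, b', h3, h4⟩ := by
    rintro b b' _ _ _ _ rfl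
    rfl
  refine this _ _ _ _ _ _ (Module.Basis.eq_of_apply_eq fun j => ?_)
  refine Eq.trans ?_ (OrthoFrame.act_basis (c.frameMap e) A j).symm
  change (c.toDiffeo.mfderivToContinuousLinearEquiv (by simp) e.base) ((e.act A).basis j) = _
  rw [OrthoFrame.act_basis, map_sum]
  simp only [map_smul]
  rfl

end IsometricInvolution

end Geometry

/-- A `Spin^c` structure on an oriented Riemannian 4-manifold: a principal `Spin^c(4)`-bundle
with a map to the bundle `P` of oriented orthonormal frames, over `X`, which is equivariant
with respect to `Spin^c(4) → SO(4)`. -/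
structure SpincStructure {X : Type u} [TopologicalSpace X]
    [ChartedSpace (EuclideanSpace ℝ (Fin 4)) X] [IsManifold (𝓡 4) ∞ X]
    (g : RiemannianMetric4 X) (o : Orientation4 X) extends
    PrincipalBundle.{u, v, 0} Spinc4 X where
  toFrame : total → OrthoFrame g o
  continuous_toFrame : Continuous toFrame
  base_toFrame : ∀ p, (toFrame p).base = proj p
  toFrame_act : ∀ p k, toFrame (act p k) = (toFrame p).act k.toSO

namespace SpincStructure

variable {X : Type u} [TopologicalSpace X]
  [ChartedSpace (EuclideanSpace ℝ (Fin 4)) X] [IsManifold (𝓡 4) ∞ X]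
  {g : RiemannianMetric4 X} {o : Orientation4 X}

/-- The determinant bundle `Q` of a `Spin^c` structure. -/
def detBundle (S : SpincStructure.{u, v} g o) : PrincipalBundle Circle X :=
  S.toPrincipalBundle.extend Spinc4.det Spinc4.continuous_det

/-- The canonical map from a `Spin^c` structure to its determinant bundle. -/
def toDet (S : SpincStructure.{u, v} g o) : S.total → S.detBundle.total :=
  S.toPrincipalBundle.toExtend Spinc4.det Spinc4.continuous_det

theorem act_toDet (S : SpincStructure.{u, v} g o) (p : S.total) (k : Spinc4) :
    S.toDet (S.act p k) = S.detBundle.act (S.toDet p) k.det :=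
  Quotient.sound (s := S.toPrincipalBundle.extendSetoid Spinc4.det)
    ⟨k, rfl, by simp⟩

end SpincStructure

section Cech

open TopologicalSpace

variable (X : Type u) [TopologicalSpace X]

/-- An open cover of `X` indexed by the points of `X`, the set of index `x` being a neighbourhood
of `x`. Every open cover is refined by one of this form. -/
structure PointedCover where
  nhd : X → Opens X
  mem_nhd : ∀ x, x ∈ nhd x

variable {X}

namespace PointedCover

/-- `U ≤ V` when `V` refines `U`. -/
instance : Preorder (PointedCover X) where
  le U V := ∀ x, V.nhd x ≤ U.nhd x
  le_refl _ _ := le_rfl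
  le_trans _ _ _ h h' x := (h' x).trans (h x)

/-- Čech 0-cochains with values in the constant sheaf `ℤ/2`. -/
abbrev C0 (U : PointedCover X) : Type u := ∀ x, LocallyConstant (U.nhd x) (ZMod 2)

/-- Čech 1-cochains with values in the constant sheaf `ℤ/2`. -/
abbrev C1 (U : PointedCover X) : Type u :=
  ∀ x y, LocallyConstant ↥(U.nhd x ⊓ U.nhd y) (ZMod 2)

/-- Čech 1-cocycles with values in `ℤ/2`. -/
def Z1 (U : PointedCover X) : AddSubgroup U.C1 where
  carrier := {a | ∀ (x y w z : X) (hx : z ∈ U.nhd x) (hy : z ∈ U.nhd y) (hw : z ∈ U.nhd w),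
    a x y ⟨z, hx, hy⟩ + a y w ⟨z, hy, hw⟩ = a x w ⟨z, hx, hw⟩}
  zero_mem' := fun x y w z hx hy hw => by simp
  add_mem' := fun {a b} ha hb x y w z hx hy hw => by
    have h1 := ha x y w z hx hy hw
    have h2 := hb x y w z hx hy hw
    simp only [Pi.add_apply, LocallyConstant.coe_add] at *
    rw [← h1, ← h2]
    abel
  neg_mem' := fun {a} ha x y w z hx hy hw => by
    have h1 := ha x y w z hx hy hw
    simp only [Pi.neg_apply, LocallyConstant.coe_neg] at *
    rw [← h1]
    abel

/-- The Čech differential from 0-cochains to 1-cocycles, `(db)_xy = b_y - b_x`. -/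
def d0 (U : PointedCover X) : U.C0 →+ U.Z1 where
  toFun b := ⟨fun x y =>
    LocallyConstant.comap
        (⟨fun z => ⟨z.1, z.2.2⟩, by fun_prop⟩ : C(↥(U.nhd x ⊓ U.nhd y), U.nhd y)) (b y) -
      LocallyConstant.comap
        (⟨fun z => ⟨z.1, z.2.1⟩, by fun_prop⟩ : C(↥(U.nhd x ⊓ U.nhd y), U.nhd x)) (b x),
    fun x y w z hx hy hw => by
      change (b y ⟨z, hy⟩ - b x ⟨z, hx⟩) + (b w ⟨z, hw⟩ - b y ⟨z, hy⟩) =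
        b w ⟨z, hw⟩ - b x ⟨z, hx⟩
      abel⟩
  map_zero' := by
    apply Subtype.ext
    funext x y
    ext z
    exact sub_zero (0 : ZMod 2)
  map_add' a b := by
    apply Subtype.ext
    funext x y
    ext z
    exact add_sub_add_comm (a y ⟨z.1, z.2.2⟩) (b y ⟨z.1, z.2.2⟩) (a x ⟨z.1, z.2.1⟩)
      (b x ⟨z.1, z.2.1⟩)

/-- The Čech cohomology group `H¹(U, ℤ/2)` of a cover. -/
abbrev H1 (U : PointedCover X) : Type u := U.Z1 ⧸ U.d0.range

/-- Restriction of cocycles to a refinement. -/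
def restrictZ1 {U V : PointedCover X} (h : U ≤ V) : U.Z1 →+ V.Z1 where
  toFun a := ⟨fun x y => LocallyConstant.comap
      (⟨fun z => ⟨z.1, h x z.2.1, h y z.2.2⟩, by fun_prop⟩ :
        C(↥(V.nhd x ⊓ V.nhd y), ↥(U.nhd x ⊓ U.nhd y))) (a.1 x y),
    fun x y w z hx hy hw => a.2 x y w z (h x hx) (h y hy) (h w hw)⟩
  map_zero' := rfl
  map_add' _ _ := rfl

/-- The map `H¹(U, ℤ/2) → H¹(V, ℤ/2)` for a refinement `V` of `U`. -/
def restrictH1 (U V : PointedCover X) (h : U ≤ V) : U.H1 →+ V.H1 :=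
  QuotientAddGroup.map _ _ (restrictZ1 h) (by
    rintro _ ⟨b, rfl⟩
    exact ⟨fun x => LocallyConstant.comap
        (⟨fun z => ⟨z.1, h x z.2⟩, by fun_prop⟩ : C(V.nhd x, U.nhd x)) (b x), rfl⟩)

end PointedCover

variable (X)

open scoped Classical in
/-- The Čech cohomology group `H¹(X, ℤ/2)`, the direct limit over the open covers of `X`. -/
abbrev CechH1 : Type u :=
  AddCommGroup.DirectLimit (fun U : PointedCover X => U.H1) PointedCover.restrictH1

variable {X}

open scoped Classical in
/-- The class in `H¹(X, ℤ/2)` of a cocycle. -/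
def CechH1.mk {U : PointedCover X} (a : U.Z1) : CechH1 X :=
  AddCommGroup.DirectLimit.of (fun U : PointedCover X => U.H1) PointedCover.restrictH1 U
    (QuotientAddGroup.mk a)

end Cech

/-- A real structure on a principal `U(1)`-bundle `Q` over `X`: an antilinear involution of `Q`
covering `c`. Note that `z⁻¹` is the complex conjugate of `z : U(1)`. -/
structure RealInvolution {X : Type u} [TopologicalSpace X] (Q : PrincipalBundle.{u, v, 0} Circle X)
    (c : X → X) where
  toFun : Q.total → Q.total
  continuous_toFun : Continuous toFun
  proj_toFun : ∀ q, Q.proj (toFun q) = c (Q.proj q)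
  antilinear : ∀ q z, toFun (Q.act q z) = Q.act (toFun q) z⁻¹
  involutive : ∀ q, toFun (toFun q) = q

namespace SpincStructure

variable {X : Type u} [TopologicalSpace X]
  [ChartedSpace (EuclideanSpace ℝ (Fin 4)) X] [IsManifold (𝓡 4) ∞ X]
  {g : RiemannianMetric4 X} {o : Orientation4 X}

/-- The conjugate `Spin^c` structure `-𝔰`: same total space and same map to `P`, with the action
of `Spin^c(4)` composed with complex conjugation. -/
def neg (S : SpincStructure.{u, v} g o) : SpincStructure.{u, v} g o where
  toPrincipalBundle := S.toPrincipalBundle.twist Spinc4.conj Spinc4.continuous_conj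
    Spinc4.conj_conj
  toFrame := S.toFrame
  continuous_toFrame := S.continuous_toFrame
  base_toFrame := S.base_toFrame
  toFrame_act p k := (S.toFrame_act p k.conj).trans (by rw [Spinc4.toSO_conj])

/-- The pulled back `Spin^c` structure `c^*𝔰`. Its fibre over `x` is the fibre of `𝔰` over `c(x)`,
mapped to `P_x` by the map of `𝔰` to `P_{c(x)}` followed by the inverse of `dc : P_x → P_{c(x)}`,
that is, by `dc : P_{c(x)} → P_x`. -/
def pullback (S : SpincStructure.{u, v} g o) (c : IsometricInvolution g o) :
    SpincStructure.{u, max u v} g o where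
  toPrincipalBundle := S.toPrincipalBundle.pullback c c.continuous
  toFrame a := c.frameMap (S.toFrame a.1.2)
  continuous_toFrame := c.continuous_frameMap.comp (S.continuous_toFrame.comp
    (continuous_snd.comp continuous_subtype_val))
  base_toFrame a := by
    change c (S.toFrame a.1.2).base = a.1.1
    rw [S.base_toFrame, a.2]
    exact c.involutive _
  toFrame_act a k := by
    change c.frameMap (S.toFrame (S.act a.1.2 k)) = _
    rw [S.toFrame_act, c.frameMap_act]

/-- Isomorphisms of `Spin^c` structures: equivariant homeomorphisms over `P`. -/
structure Iso (S : SpincStructure.{u, v} g o) (T : SpincStructure.{u, w} g o) where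
  toHomeomorph : S.total ≃ₜ T.total
  map_act : ∀ p k, toHomeomorph (S.act p k) = T.act (toHomeomorph p) k
  map_toFrame : ∀ p, T.toFrame (toHomeomorph p) = S.toFrame p

variable (S : SpincStructure.{u, v} g o) (c : IsometricInvolution g o)
  (cQ : RealInvolution S.detBundle c)

/-- `c^*𝔰 = -𝔰`, where the determinant bundle `-Q` of `-𝔰` is identified with the determinant
bundle `c^*Q` of `c^*𝔰` by means of the real structure `c_Q`: there is an isomorphism of `Spin^c`
structures `-𝔰 → c^*𝔰` inducing `c_Q` on the determinant bundles. (A point of `c^*𝔰` is a pair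
`(x, q)` with `q ∈ 𝔰` over `c(x)`; a point of `-𝔰` is a point of `𝔰`.) -/
def PullbackEqNeg : Prop :=
  ∃ Φ : Iso S.neg (S.pullback c),
    ∀ p : S.total, S.toDet (Φ.toHomeomorph p).1.2 = cQ.toFun (S.toDet p)

/-- `f` is, over `U ⊆ X`, an antilinear lift to `𝔰` of `dc : P → P` inducing `c_Q` on the
determinant bundle. (Values of `f` at points that are not over `U` play no role.) -/
def IsRealLiftOn (U : Set X) (f : S.total → S.total) : Prop :=
  ContinuousOn f (S.proj ⁻¹' U) ∧ ∀ p ∈ S.proj ⁻¹' U,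
    S.toFrame (f p) = c.frameMap (S.toFrame p) ∧
    S.toDet (f p) = cQ.toFun (S.toDet p) ∧
    ∀ k, f (S.act p k) = S.act (f p) k.conj

/-- The set `C_𝔰` of antilinear lifts of `dc` to `𝔰` inducing `c_Q` on the determinant bundle. -/
def realLifts : Set (S.total → S.total) := {f | S.IsRealLiftOn c cQ Set.univ f}

/-- `μ ∈ H¹(X, ℤ/2)` is the class of the cocycle of signs by which local antilinear lifts of `dc`
over the members of an open cover differ from each other. -/
def IsRealObstruction (μ : CechH1 X) : Prop :=
  ∃ (U : PointedCover X) (a : U.Z1) (f : X → S.total → S.total),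
    (∀ x, S.IsRealLiftOn c cQ (U.nhd x) (f x)) ∧
    (∀ (x y : X) (p : S.total) (hx : S.proj p ∈ U.nhd x) (hy : S.proj p ∈ U.nhd y),
      f x p = S.act (f y p) (Spinc4.sign (a.1 x y ⟨S.proj p, hx, hy⟩))) ∧
    CechH1.mk a = μ

end SpincStructure

end

/-!
The map `(toSO, det) : Spin^c(4) → SO(4) × U(1)` is a double covering with kernel the central
subgroup `{± 1}`, which is fixed by complex conjugation (`Spinc4.isCoveringMap_toSODet`).
Surjectivity of `Sp(1) × Sp(1) → SO(4)` is the only part of this that needs an argument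
(`Spinc4.rot_surjective`); compactness gives the covering property. Consequently `𝔰 → P ×_X Q`
is a double covering whose fibres are the orbits of `± 1` (`SpincStructure.exists_sign`).

An antilinear lift over a small open set is determined by the image of one local section of `𝔰`,
and this image is a lift of a section of `P ×_X Q` along the double covering. So lifts exist
locally (`SpincStructure.exists_isRealLiftOn`), and two lifts over the same open set differ by a
locally constant sign on the base (`SpincStructure.exists_sign_function`). The signs comparing
the lifts of a family form a Čech cocycle; on a common refinement, the signs comparing two
families form a cochain whose differential is the difference of the cocycles
(`SpincStructure.IsRealObstruction.eq`). If the class vanishes, the lifts can be multiplied by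
signs so as to agree on the overlaps, and they glue to a global lift
(`SpincStructure.isRealObstruction_zero_iff`).

The square of a global lift `f` lifts the identity of `P ×_X Q`, so on the connected manifold
`X` it is a constant sign, and replacing `f` by `± f` does not change it
(`SpincStructure.existsUnique_sign_sq`). In particular `f` is a homeomorphism with inverse `±
f`, and `p ↦ (π(p), f(p))`, where `π : 𝔰 → X` is the projection, is an isomorphism `-𝔰 → c^*𝔰`;
every such isomorphism inducing `c_Q` arises in this way
(`SpincStructure.realLifts_nonempty_iff`).
-/

/-! ### The double covering `Spin^c(4) → SO(4) × U(1)` -/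

namespace Spinc4

/-- The quaternion `a + b i + c j + d k`. -/
def quat (a b c d : ℝ) : ℍ[ℝ] := ⟨a, b, c, d⟩

@[simp] theorem re_quat (a b c d : ℝ) : (quat a b c d).re = a := rfl

@[simp] theorem imI_quat (a b c d : ℝ) : (quat a b c d).imI = b := rfl

@[simp] theorem imJ_quat (a b c d : ℝ) : (quat a b c d).imJ = c := rfl

@[simp] theorem imK_quat (a b c d : ℝ) : (quat a b c d).imK = d := rfl

theorem rotEnd_apply (a : Sp1 × Sp1) (x : ℍ[ℝ]) :
    rotEnd a x = (a.1 : ℍ[ℝ]) * x * star (a.2 : ℍ[ℝ]) := by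
  simp [rotEnd, mul_assoc]

@[simp] theorem quat_inj {a b c d a' b' c' d' : ℝ} :
    quat a b c d = quat a' b' c' d' ↔ a = a' ∧ b = b' ∧ c = c' ∧ d = d' := by
  rw [Quaternion.ext_iff]
  rfl

/-- The `j`-th column of a `4 × 4` matrix, as a quaternion. -/
noncomputable def column (A : Matrix (Fin 4) (Fin 4) ℝ) (j : Fin 4) : ℍ[ℝ] :=
  Matrix.toLin quatBasis quatBasis A (quatBasis j)

theorem repr_column (A : Matrix (Fin 4) (Fin 4) ℝ) (i j : Fin 4) :
    quatBasis.repr (column A j) i = A i j := by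
  rw [column, ← LinearMap.toMatrix_apply, LinearMap.toMatrix_toLin]

theorem column_eq (A : Matrix (Fin 4) (Fin 4) ℝ) (j : Fin 4) :
    column A j = quat (A 0 j) (A 1 j) (A 2 j) (A 3 j) := by
  have h : ∀ q : ℍ[ℝ], quatBasis.repr q = ![q.re, q.imI, q.imJ, q.imK] := fun q => rfl
  have := fun i => repr_column A i j
  simp only [h] at this
  ext
  · exact this 0
  · exact this 1
  · exact this 2
  · exact this 3

theorem column_rot_mul (a : Sp1 × Sp1) (A : Matrix.specialOrthogonalGroup (Fin 4) ℝ) (j : Fin 4) :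
    column (rot a * A : Matrix.specialOrthogonalGroup (Fin 4) ℝ) j =
      (a.1 : ℍ[ℝ]) * column A j * star (a.2 : ℍ[ℝ]) := by
  rw [← rotEnd_apply]
  have h : Matrix.toLin quatBasis quatBasis (rot a : Matrix (Fin 4) (Fin 4) ℝ) = rotEnd a :=
    Matrix.toLin_toMatrix quatBasis quatBasis (rotEnd a)
  rw [← h, column, column, ← LinearMap.comp_apply, ← Matrix.toLin_mul]
  rfl

theorem column_orthonormal (A : Matrix.specialOrthogonalGroup (Fin 4) ℝ) (i j : Fin 4) :
    (column A i * star (column A j)).re = if i = j then 1 else 0 := by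
  have h := (Matrix.mem_orthogonalGroup_iff' (Fin 4) ℝ).1
    (Matrix.mem_specialOrthogonalGroup_iff.1 A.2).1
  have h' := congrFun (congrFun h i) j
  rw [Matrix.mul_apply, Matrix.one_apply, Fin.sum_univ_four] at h'
  rw [← h', column_eq, column_eq]
  simp

/-- A quaternion of norm one, as an element of `Sp(1)`. -/
noncomputable def ofNormSq (q : ℍ[ℝ]) (h : Quaternion.normSq q = 1) : Sp1 :=
  ⟨q, Unitary.mem_iff.2 ⟨by rw [Quaternion.star_mul_self, h]; rfl,
    by rw [Quaternion.self_mul_star, h]; rfl⟩⟩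

theorem star_mul_coe (p : Sp1) : star (p : ℍ[ℝ]) * p = 1 := (Unitary.mem_iff.1 p.2).1

/-- Any two anticommuting square roots `b`, `c` of `-1` in `ℍ` are simultaneously conjugate to `i`
and `j`: up to norm, a conjugating element is the sum `∑ β(e) r ē` over the basis
`e = 1, i, j, k`, where `β` is the endomorphism of `ℍ` with `β(i) = b`, `β(j) = c`. It is nonzero
for some `r`. -/
theorem exists_conj_eq {b c : ℍ[ℝ]} (hb : b * b = -1) (hc : c * c = -1) (hbc : b * c = -(c * b)) :
    ∃ p : Sp1, (p : ℍ[ℝ]) * quat 0 1 0 0 * star (p : ℍ[ℝ]) = b ∧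
      (p : ℍ[ℝ]) * quat 0 0 1 0 * star (p : ℍ[ℝ]) = c := by
  set I : ℍ[ℝ] := quat 0 1 0 0 with hI
  set J : ℍ[ℝ] := quat 0 0 1 0 with hJ
  set K : ℍ[ℝ] := quat 0 0 0 1 with hK
  have hII : I * I = -1 := by ext <;> simp [hI]
  have hJJ : J * J = -1 := by ext <;> simp [hJ]
  have hIJ : I * J = K := by ext <;> simp [hI, hJ, hK]
  have hJI : J * I = -K := by ext <;> simp [hI, hJ, hK]
  have hKI : K * I = J := by ext <;> simp [hI, hJ, hK]
  have hKJ : K * J = -I := by ext <;> simp [hI, hJ, hK]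
  -- `P r = ∑ β(e) r ē`; conjugation changes the sign of `I`, `J`, `K`
  let P : ℍ[ℝ] → ℍ[ℝ] := fun r => r - b * r * I - c * r * J - b * c * r * K
  have hPI : ∀ r, b * P r = P r * I := by
    intro r
    have e1 : b * P r = b * r - (b * b) * r * I - b * c * r * J - (b * b) * c * r * K := by
      simp only [P]; noncomm_ring
    have e2 : P r * I = r * I - b * r * (I * I) - c * r * (J * I) - b * c * r * (K * I) := by
      simp only [P]; noncomm_ring
    rw [e1, e2, hb, hII, hJI, hKI]
    noncomm_ring
  have hPJ : ∀ r, c * P r = P r * J := by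
    intro r
    have e1 : c * P r = c * r - c * b * r * I - (c * c) * r * J - (c * b) * c * r * K := by
      simp only [P]; noncomm_ring
    have e2 : P r * J = r * J - b * r * (I * J) - c * r * (J * J) - b * c * r * (K * J) := by
      simp only [P]; noncomm_ring
    have hcb : c * b = -(b * c) := by rw [hbc, neg_neg]
    have hcbc : c * b * c = b := by rw [hcb, neg_mul, mul_assoc, hc, mul_neg, mul_one, neg_neg]
    rw [e1, e2, hcbc, hcb, hc, hIJ, hJJ, hKJ]
    noncomm_ring
  -- `∑ r ē r̄` over the basis elements `r` is `4 Re e`, so `∑ P r * star r = 4`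
  have hne : ∃ r, P r ≠ 0 := by
    by_contra! h
    have hs : P 1 - P I * I - P J * J - P K * K = ((4 : ℝ) : ℍ[ℝ]) := by
      have hS : ∀ x : ℍ[ℝ], x - I * x * I - J * x * J - K * x * K = ((4 * x.re : ℝ) : ℍ[ℝ]) := by
        intro x
        ext <;> simp [hI, hJ, hK]
        ring
      have e : P 1 - P I * I - P J * J - P K * K =
          (1 - I * 1 * I - J * 1 * J - K * 1 * K) - b * (I - I * I * I - J * I * J - K * I * K)
          - c * (J - I * J * I - J * J * J - K * J * K)
          - b * c * (K - I * K * I - J * K * J - K * K * K) := by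
        simp only [P]; noncomm_ring
      rw [e, hS, hS, hS, hS]
      simp [hI, hJ, hK]
    simp only [h, zero_mul, sub_zero] at hs
    have := congrArg QuaternionAlgebra.re hs
    norm_num at this
  obtain ⟨r, hr⟩ := hne
  have hn : Quaternion.normSq (P r) ≠ 0 := by rwa [ne_eq, Quaternion.normSq_eq_zero]
  have hpos : 0 < Quaternion.normSq (P r) := lt_of_le_of_ne Quaternion.normSq_nonneg hn.symm
  set t : ℝ := (Real.sqrt (Quaternion.normSq (P r)))⁻¹ with ht
  have htt : t * t * Quaternion.normSq (P r) = 1 := by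
    rw [ht, ← mul_inv, Real.mul_self_sqrt hpos.le, inv_mul_cancel₀ hn]
  have hN : Quaternion.normSq (t • P r) = 1 := by
    rw [Quaternion.normSq_smul, sq, htt]
  have key : ∀ x y : ℍ[ℝ], y * P r = P r * x →
      ((ofNormSq (t • P r) hN : Sp1) : ℍ[ℝ]) * x * star ((ofNormSq (t • P r) hN : Sp1) : ℍ[ℝ]) =
        y := by
    intro x y h
    have h1 : ((ofNormSq (t • P r) hN : Sp1) : ℍ[ℝ]) * x =
        y * ((ofNormSq (t • P r) hN : Sp1) : ℍ[ℝ]) := by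
      change (t • P r) * x = y * (t • P r)
      rw [smul_mul_assoc, mul_smul_comm, h]
    rw [h1, mul_assoc, (Unitary.mem_iff.1 (ofNormSq (t • P r) hN).2).2, mul_one]
  exact ⟨ofNormSq (t • P r) hN, key _ _ (hPI r), key _ _ (hPJ r)⟩

theorem mul_self_of_re_eq_zero {b : ℍ[ℝ]} (h0 : b.re = 0) (h1 : (b * star b).re = 1) :
    b * b = -1 := by
  have h : star b = -b := by ext <;> simp [h0]
  rw [Quaternion.self_mul_star, Quaternion.re_coe] at h1
  have h2 := Quaternion.self_mul_star b
  rw [h1, h, mul_neg] at h2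
  rw [← neg_eq_iff_eq_neg, h2, Quaternion.coe_one]

/-- A matrix in `SO(4)` whose first three columns are those of the identity is the identity. -/
theorem eq_one_of_column {A : Matrix.specialOrthogonalGroup (Fin 4) ℝ}
    (h0 : column A 0 = quat 1 0 0 0) (h1 : column A 1 = quat 0 1 0 0)
    (h2 : column A 2 = quat 0 0 1 0) : A = 1 := by
  have o0 := column_orthonormal A 0 3
  have o1 := column_orthonormal A 1 3
  have o2 := column_orthonormal A 2 3
  have hd := (Matrix.mem_specialOrthogonalGroup_iff.1 A.2).2
  rw [h0, column_eq] at o0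
  rw [h1, column_eq] at o1
  rw [h2, column_eq] at o2
  rw [column_eq] at h0 h1 h2
  simp at o0 o1 o2 h0 h1 h2
  obtain ⟨a0, a1, a2, a3⟩ := h0
  obtain ⟨b0, b1, b2, b3⟩ := h1
  obtain ⟨c0, c1, c2, c3⟩ := h2
  have h33 : (A : Matrix (Fin 4) (Fin 4) ℝ) 3 3 = 1 := by
    simpa [Matrix.det_succ_row_zero, Fin.sum_univ_succ, Fin.succAbove, a0, a1, a2, a3, b0, b1, b2,
      b3, c0, c1, c2, c3, o0, o1, o2] using hd
  apply Subtype.ext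
  ext i j
  fin_cases i <;> fin_cases j <;> simp [*]

/-- Composing `A` with suitable elements of the image of `rot` successively fixes `1`, by a left
multiplication, and `i`, `j`, by a conjugation; a rotation fixing `1`, `i`, `j` is the identity. -/
theorem rot_surjective : Function.Surjective rot := by
  intro A
  have hu : Quaternion.normSq (column A 0) = 1 := by
    have := column_orthonormal A 0 0
    rwa [Quaternion.self_mul_star, Quaternion.re_coe, if_pos rfl] at this
  let p : Sp1 := ofNormSq _ hu
  let B : Matrix.specialOrthogonalGroup (Fin 4) ℝ := rot (p⁻¹, 1) * A
  have hA : A = rot (p, 1) * B := by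
    rw [← mul_assoc, ← map_mul, show (p, 1) * (p⁻¹, 1) = (1 : Sp1 × Sp1) by simp, map_one, one_mul]
  have hB0 : column B 0 = 1 := by
    rw [column_rot_mul]
    change star (p : ℍ[ℝ]) * (p : ℍ[ℝ]) * star 1 = 1
    rw [star_mul_coe, star_one, mul_one]
  have hre : ∀ j, j ≠ 0 → (column B j).re = 0 := by
    intro j hj
    have := column_orthonormal B j 0
    rwa [hB0, star_one, mul_one, if_neg hj] at this
  have hsq : ∀ j, j ≠ 0 → column B j * column B j = -1 := fun j hj =>
    mul_self_of_re_eq_zero (hre j hj) (by rw [column_orthonormal, if_pos rfl])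
  have hanti : column B 1 * column B 2 = -(column B 2 * column B 1) := by
    have h := column_orthonormal B 1 2
    have h1 := hre 1 (by decide)
    have h2 := hre 2 (by decide)
    rw [if_neg (by decide)] at h
    simp only [Quaternion.re_mul, Quaternion.re_star, Quaternion.imI_star, Quaternion.imJ_star,
      Quaternion.imK_star, h1, h2] at h
    ext <;> simp [h1, h2] <;> linarith
  obtain ⟨q, hq1, hq2⟩ := exists_conj_eq (hsq 1 (by decide)) (hsq 2 (by decide)) hanti
  have hC : ∀ x : ℍ[ℝ], ((q⁻¹ : Sp1) : ℍ[ℝ]) * ((q : ℍ[ℝ]) * x * star (q : ℍ[ℝ])) *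
      star ((q⁻¹ : Sp1) : ℍ[ℝ]) = x := by
    intro x
    change star (q : ℍ[ℝ]) * ((q : ℍ[ℝ]) * x * star (q : ℍ[ℝ])) * star (star (q : ℍ[ℝ])) = x
    rw [star_star, mul_assoc, mul_assoc (_ * x), star_mul_coe, mul_one, ← mul_assoc, star_mul_coe,
      one_mul]
  have hD : rot (q⁻¹, q⁻¹) * B = 1 := by
    apply eq_one_of_column
    · have h1 : (q : ℍ[ℝ]) * 1 * star (q : ℍ[ℝ]) = column B 0 := by
        rw [hB0, mul_one, (Unitary.mem_iff.1 q.2).2]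
      rw [column_rot_mul, ← h1]
      exact hC 1
    · rw [column_rot_mul, ← hq1]
      exact hC _
    · rw [column_rot_mul, ← hq2]
      exact hC _
  refine ⟨(p, 1) * (q, q), ?_⟩
  have hB : B = rot (q, q) := by
    rw [← one_mul B, ← map_one rot, show (1 : Sp1 × Sp1) = (q, q) * (q⁻¹, q⁻¹) by
        rw [Prod.mk_mul_mk, mul_inv_cancel]; rfl,
      map_mul, mul_assoc, hD, mul_one]
  rw [map_mul, hA, hB]

theorem eq_of_rot_eq_one {a : Sp1 × Sp1} (h : rot a = 1) : a = 1 ∨ a = -1 := by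
  -- the value at `1` gives `a.1 = a.2`, which then commutes with `i` and `j`, so it is real
  have hx : ∀ x : ℍ[ℝ], (a.1 : ℍ[ℝ]) * x * star (a.2 : ℍ[ℝ]) = x := by
    have : rotEnd a = 1 := (LinearMap.toMatrixAlgEquiv quatBasis).injective (by
      rw [map_one]
      exact congrArg Subtype.val h)
    intro x
    rw [← rotEnd_apply, this]
    rfl
  have hcomm : ∀ x : ℍ[ℝ], (a.1 : ℍ[ℝ]) * x = x * (a.2 : ℍ[ℝ]) := by
    intro x
    conv_rhs => rw [← hx x]
    rw [mul_assoc, star_mul_coe, mul_one]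
  have h12 : a.1 = a.2 := Subtype.ext (by simpa using hcomm 1)
  have hI := hcomm (quat 0 1 0 0)
  have hJ := hcomm (quat 0 0 1 0)
  rw [← h12] at hI hJ
  have hn := normSq_eq a.1
  have eI := congrArg QuaternionAlgebra.imK hI
  have eI' := congrArg QuaternionAlgebra.imJ hI
  have eJ := congrArg QuaternionAlgebra.imK hJ
  simp at eI eI' eJ
  have z1 : (a.1 : ℍ[ℝ]).imI = 0 := by linarith
  have z2 : (a.1 : ℍ[ℝ]).imJ = 0 := by linarith
  have z3 : (a.1 : ℍ[ℝ]).imK = 0 := by linarith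
  rw [z1, z2, z3] at hn
  have hr : (a.1 : ℍ[ℝ]).re = 1 ∨ (a.1 : ℍ[ℝ]).re = -1 := sq_eq_one_iff.1 (by linarith)
  rcases hr with hr | hr
  · left
    have : a.1 = 1 := Subtype.ext (by ext <;> simp [z1, z2, z3, hr])
    exact Prod.ext this (h12 ▸ this)
  · right
    have : a.1 = -1 := Subtype.ext (by rw [Unitary.coe_neg]; ext <;> simp [z1, z2, z3, hr])
    exact Prod.ext this (h12 ▸ this)

theorem isCompact_unitary_quaternion : IsCompact (unitary ℍ[ℝ] : Set ℍ[ℝ]) := by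
  refine (isCompact_closedBall (0 : ℍ[ℝ]) 1).of_isClosed_subset ?_ ?_
  · exact isClosed_unitary
  · intro p hp
    rw [mem_closedBall_zero_iff]
    exact CStarRing.norm_of_mem_unitary hp |>.le

instance : CompactSpace Sp1 := isCompact_iff_compactSpace.1 isCompact_unitary_quaternion

theorem continuous_rot : Continuous rot := by
  refine Continuous.subtype_mk ?_ _
  refine continuous_matrix fun i j => ?_
  have h : Continuous fun a : Sp1 × Sp1 => (a.1 : ℍ[ℝ]) * quatBasis j * star (a.2 : ℍ[ℝ]) := by
    fun_prop
  have h2 : Continuous fun x : ℍ[ℝ] => quatBasis.repr x i :=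
    LinearMap.continuous_of_finiteDimensional (quatBasis.coord i)
  refine (h2.comp h).congr fun a => ?_
  rw [Function.comp_apply, ← rotEnd_apply]
  exact (LinearMap.toMatrix_apply ..).symm

theorem continuous_toSO : Continuous toSO :=
  continuous_quot_lift _ (continuous_rot.comp continuous_fst)

theorem mem_signSubgroup {a : (Sp1 × Sp1) × Circle} :
    a ∈ signSubgroup ↔ a = 1 ∨ a = ((-1, -1), -1) := by
  have h2 : (((-1, -1), -1) : (Sp1 × Sp1) × Circle) ^ 2 = 1 := by
    rw [sq]
    simp
  constructor
  · intro h
    obtain ⟨k, rfl⟩ := Subgroup.mem_zpowers_iff.1 h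
    obtain ⟨m, rfl | rfl⟩ := Int.even_or_odd' k
    · left
      rw [zpow_mul, zpow_ofNat, h2, one_zpow]
    · right
      rw [zpow_add, zpow_mul, zpow_ofNat, h2, one_zpow, one_mul, zpow_one]
  · rintro (rfl | rfl)
    · exact one_mem _
    · exact Subgroup.mem_zpowers _

instance : IsClosed (signSubgroup : Set ((Sp1 × Sp1) × Circle)) := by
  refine Set.Finite.isClosed ((Set.toFinite {1, ((-1, -1), -1)}).subset fun a ha => ?_)
  exact mem_signSubgroup.1 ha

instance : T1Space Spinc4 := QuotientGroup.instT1Space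

@[simp] theorem sign_zero : sign 0 = 1 := rfl

theorem sign_one : sign 1 = QuotientGroup.mk ((1, 1), -1) := rfl

theorem sign_one_ne_one : sign 1 ≠ 1 := by
  rw [sign_one, ne_eq, QuotientGroup.eq_one_iff, mem_signSubgroup, not_or]
  have h : (-1 : Circle) ≠ 1 := fun h => by
    have := congrArg (fun z : Circle => (z : ℂ).re) h
    norm_num at this
  refine ⟨fun e => h (congrArg Prod.snd e), fun e => ?_⟩
  have := congrArg (fun a : (Sp1 × Sp1) × Circle => (a.1.1 : ℍ[ℝ]).re) e
  rw [show (((((-1, -1), -1) : (Sp1 × Sp1) × Circle).1.1 : Sp1) : ℍ[ℝ]) = -1 from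
    Unitary.coe_neg _] at this
  norm_num at this

theorem sign_injective : Function.Injective sign := by
  intro m n h
  fin_cases m <;> fin_cases n
  · rfl
  · exact absurd h.symm sign_one_ne_one
  · exact absurd h sign_one_ne_one
  · rfl

theorem sign_one_mul_self : sign 1 * sign 1 = 1 := by
  rw [sign_one, ← QuotientGroup.mk_mul, QuotientGroup.eq_one_iff]
  convert one_mem signSubgroup using 1
  refine Prod.ext ?_ ?_ <;> simp

theorem sign_add (m n : ZMod 2) : sign (m + n) = sign m * sign n := by
  fin_cases m <;> fin_cases n
  · exact (one_mul 1).symm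
  · exact (one_mul _).symm
  · exact (mul_one _).symm
  · exact sign_one_mul_self.symm

theorem sign_mul_comm (n : ZMod 2) (k : Spinc4) : sign n * k = k * sign n := by
  fin_cases n
  · exact (one_mul k).trans (mul_one k).symm
  · induction k using QuotientGroup.induction_on with
    | H z =>
      change sign 1 * _ = _ * sign 1
      rw [sign_one, ← QuotientGroup.mk_mul, ← QuotientGroup.mk_mul]
      congr 1
      refine Prod.ext (Prod.ext ?_ ?_) ?_ <;> simp

@[simp] theorem conj_sign (n : ZMod 2) : conj (sign n) = sign n := by
  fin_cases n
  · exact map_one conj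
  · change conj (sign 1) = sign 1
    rw [sign_one, conj, QuotientGroup.map_mk]
    congr 1
    simp

theorem isClosedEmbedding_sign : Topology.IsClosedEmbedding sign :=
  .of_continuous_injective_isClosedMap continuous_of_discreteTopology sign_injective
    fun s _ => (s.toFinite.image sign).isClosed

theorem det_conj (k : Spinc4) : (conj k).det = k.det⁻¹ := by
  induction k using QuotientGroup.induction_on with
  | H z => exact inv_pow z.2 2

/-- The homomorphism `Spin^c(4) → SO(4) × U(1)`, a double covering with kernel `{± 1}`. -/
noncomputable def toSODet : Spinc4 →* Matrix.specialOrthogonalGroup (Fin 4) ℝ × Circle :=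
  toSO.prod det

theorem toSODet_surjective : Function.Surjective toSODet := by
  rintro ⟨A, w⟩
  obtain ⟨a, rfl⟩ := rot_surjective A
  obtain ⟨t, rfl⟩ := Circle.exp_surjective w
  refine ⟨QuotientGroup.mk (a, Circle.exp (t / 2)), Prod.ext rfl ?_⟩
  change Circle.exp (t / 2) ^ 2 = Circle.exp t
  rw [sq, ← Circle.exp_add, add_halves]

theorem toSODet_eq_one_iff {k : Spinc4} : toSODet k = 1 ↔ ∃ n, k = sign n := by
  constructor
  · intro h
    induction k using QuotientGroup.induction_on with
    | H a =>
      obtain ⟨a, z⟩ := a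
      have ha : rot a = 1 := congrArg Prod.fst h
      have hz : z ^ 2 = 1 := congrArg Prod.snd h
      have hz' : z = 1 ∨ z = -1 := by
        rcases sq_eq_one_iff.1
          (show (z : ℂ) ^ 2 = 1 by rw [← Circle.coe_pow, hz, Circle.coe_one]) with h | h
        · exact Or.inl (Circle.ext h)
        · exact Or.inr (Circle.ext (by rw [h]; simp))
      rcases eq_of_rot_eq_one ha with rfl | rfl <;> rcases hz' with rfl | rfl
      · exact ⟨0, rfl⟩
      · exact ⟨1, rfl⟩
      · refine ⟨1, QuotientGroup.eq.2 (mem_signSubgroup.2 (Or.inr ?_))⟩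
        refine Prod.ext (Prod.ext ?_ ?_) ?_ <;> simp
      · refine ⟨0, QuotientGroup.eq.2 (mem_signSubgroup.2 (Or.inr ?_))⟩
        refine Prod.ext (Prod.ext ?_ ?_) ?_ <;> simp
  · rintro ⟨n, rfl⟩
    fin_cases n
    · exact map_one toSODet
    · change (rot 1, (-1 : Circle) ^ 2) = 1
      rw [map_one, neg_one_sq]
      rfl

/-- A continuous surjective homomorphism from a compact group to a Hausdorff group, with finite
kernel, is a covering. -/
theorem isCoveringMap_toSODet : IsCoveringMap toSODet := by
  have hc : Continuous toSODet := continuous_toSO.prodMk continuous_det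
  have hq : Topology.IsQuotientMap toSODet :=
    hc.isClosedMap.isQuotientMap hc toSODet_surjective
  refine (hq.isQuotientCoveringMap_of_isDiscrete_ker_monoidHom ?_).isCoveringMap
  refine ((Set.finite_range sign).subset fun k hk => ?_).isDiscrete
  obtain ⟨n, rfl⟩ := toSODet_eq_one_iff.1 hk
  exact ⟨n, rfl⟩

/-- Continuous maps to `SO(4) × U(1)` lift locally to `Spin^c(4)`. -/
theorem exists_local_lift {Y : Type*} [TopologicalSpace Y]
    {h : Y → Matrix.specialOrthogonalGroup (Fin 4) ℝ × Circle} {s : Set Y} (hs : IsOpen s)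
    (hh : ContinuousOn h s) {y : Y} (hy : y ∈ s) :
    ∃ V ⊆ s, IsOpen V ∧ y ∈ V ∧ ∃ k : Y → Spinc4, ContinuousOn k V ∧
      ∀ z ∈ V, toSODet (k z) = h z := by
  obtain ⟨k₀, hk₀⟩ := toSODet_surjective (h y)
  obtain ⟨e, he, hee⟩ := isCoveringMap_toSODet.isLocalHomeomorph k₀
  refine ⟨s ∩ h ⁻¹' e.target, Set.inter_subset_left, hh.isOpen_inter_preimage hs e.open_target,
    ⟨hy, ?_⟩, e.symm ∘ h, e.continuousOn_symm.comp (hh.mono Set.inter_subset_left)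
      fun z hz => hz.2, fun z hz => ?_⟩
  · rw [Set.mem_preimage, ← hk₀, hee]
    exact e.map_source he
  · rw [hee]
    exact e.right_inv hz.2

end Spinc4

/-! ### Differences and sections in principal bundles -/

namespace PrincipalBundle

variable {G : Type w} [Group G] [TopologicalSpace G] {X : Type u} [TopologicalSpace X]
  (E : PrincipalBundle.{u, v, w} G X)

theorem act_eq_triv {U : Set X} (φ : U × G ≃ₜ E.proj ⁻¹' U) (h1 : ∀ a, E.proj (φ a) = a.1)
    (h2 : ∀ y k l, (φ (y, k * l) : E.total) = E.act (φ (y, k)) l)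
    {p : E.total} (hp : E.proj p ∈ U) (k : G) :
    E.act p k = φ (⟨E.proj p, hp⟩, (φ.symm ⟨p, hp⟩).2 * k) := by
  rw [h2, E.exists_extend_triv φ h1 p hp]

theorem exists_act_eq {p q : E.total} (h : E.proj p = E.proj q) : ∃ k, E.act p k = q := by
  obtain ⟨U, -, hp, φ, h1, h2⟩ := E.locally_trivial (E.proj p)
  have hq : E.proj q ∈ U := h ▸ hp
  refine ⟨(φ.symm ⟨p, hp⟩).2⁻¹ * (φ.symm ⟨q, hq⟩).2, ?_⟩
  rw [E.act_eq_triv φ h1 h2 hp, mul_inv_cancel_left]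
  have := E.exists_extend_triv φ h1 q hq
  rw [show (⟨E.proj p, hp⟩ : U) = ⟨E.proj q, hq⟩ from Subtype.ext h, this]

theorem act_injective (p : E.total) : Function.Injective (E.act p) := by
  intro k l h
  obtain ⟨U, -, hp, φ, h1, h2⟩ := E.locally_trivial (E.proj p)
  rw [E.act_eq_triv φ h1 h2 hp, E.act_eq_triv φ h1 h2 hp] at h
  have := φ.injective (Subtype.ext h)
  exact mul_left_cancel (congrArg Prod.snd this)

open scoped Classical in
/-- The element `k` of the structure group with `q = p · k`, for points `p`, `q` of the same fibre
(and `1` if they lie in different fibres). -/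
noncomputable def diff (p q : E.total) : G :=
  if h : E.proj p = E.proj q then (E.exists_act_eq h).choose else 1

theorem act_diff {p q : E.total} (h : E.proj p = E.proj q) : E.act p (E.diff p q) = q := by
  rw [diff, dif_pos h]
  exact (E.exists_act_eq h).choose_spec

theorem diff_act (p : E.total) (k : G) : E.diff p (E.act p k) = k :=
  E.act_injective p (E.act_diff (E.proj_act p k).symm)

theorem diff_act_right {p q : E.total} (h : E.proj p = E.proj q) (k : G) :
    E.diff p (E.act q k) = E.diff p q * k :=
  E.act_injective p (by rw [E.act_diff (by rw [E.proj_act, h]), E.act_mul, E.act_diff h])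

theorem continuous_act [ContinuousMul G] :
    Continuous fun x : E.total × G => E.act x.1 x.2 := by
  rw [continuous_iff_continuousAt]
  rintro ⟨p, k⟩
  obtain ⟨U, hU, hp, φ, h1, h2⟩ := E.locally_trivial (E.proj p)
  have hV : IsOpen {x : E.total × G | E.proj x.1 ∈ U} :=
    hU.preimage (E.continuous_proj.comp continuous_fst)
  refine ContinuousOn.continuousAt ?_ (hV.mem_nhds hp)
  rw [continuousOn_iff_continuous_domRestrict]
  have : Continuous fun x : {x : E.total × G | E.proj x.1 ∈ U} =>
      (φ (⟨E.proj x.1.1, x.2⟩, (φ.symm ⟨x.1.1, x.2⟩).2 * x.1.2) : E.total) := by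
    have := E.continuous_proj
    fun_prop
  exact this.congr fun x => (E.act_eq_triv φ h1 h2 x.2 _).symm

theorem continuousOn_diff [IsTopologicalGroup G] {Y : Type*} [TopologicalSpace Y]
    {a b : Y → E.total} {s : Set Y} (ha : ContinuousOn a s) (hb : ContinuousOn b s)
    (hab : ∀ y ∈ s, E.proj (a y) = E.proj (b y)) :
    ContinuousOn (fun y => E.diff (a y) (b y)) s := by
  have h : Continuous fun x : {x : E.total × E.total // E.proj x.1 = E.proj x.2} =>
      E.diff x.1.1 x.1.2 := by
    rw [continuous_iff_continuousAt]
    rintro ⟨⟨p, q⟩, hpq⟩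
    obtain ⟨U, hU, hp, φ, h1, h2⟩ := E.locally_trivial (E.proj p)
    let V := {x : {x : E.total × E.total // E.proj x.1 = E.proj x.2} | E.proj x.1.1 ∈ U}
    have hV : IsOpen V :=
      hU.preimage (E.continuous_proj.comp (continuous_fst.comp continuous_subtype_val))
    refine ContinuousOn.continuousAt ?_ (hV.mem_nhds hp)
    rw [continuousOn_iff_continuous_domRestrict]
    have hc : Continuous fun x : V =>
        (φ.symm ⟨x.1.1.1, x.2⟩).2⁻¹ *
          (φ.symm ⟨x.1.1.2, show E.proj x.1.1.2 ∈ U from x.1.2 ▸ x.2⟩).2 := by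
      fun_prop
    refine hc.congr fun x => ?_
    refine E.act_injective x.1.1.1 ?_
    rw [Set.domRestrict_apply, E.act_diff x.1.2, E.act_eq_triv φ h1 h2 x.2, mul_inv_cancel_left]
    have hq : E.proj x.1.1.2 ∈ U := x.1.2 ▸ x.2
    have := E.exists_extend_triv φ h1 x.1.1.2 hq
    rw [show (⟨E.proj x.1.1.1, x.2⟩ : U) = ⟨E.proj x.1.1.2, hq⟩ from Subtype.ext x.1.2, this]
  rw [continuousOn_iff_continuous_domRestrict] at ha hb ⊢
  exact h.comp (Continuous.subtype_mk (ha.prodMk hb) fun y => hab y.1 y.2)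

theorem exists_local_section (x : X) : ∃ (U : Set X) (s : X → E.total), IsOpen U ∧ x ∈ U ∧
    ContinuousOn s U ∧ ∀ y ∈ U, E.proj (s y) = y := by
  classical
  obtain ⟨U, hU, hx, φ, h1, -⟩ := E.locally_trivial x
  have hs : ∀ y : U, (if h : (y : X) ∈ U then (φ (⟨y, h⟩, 1) : E.total) else φ (⟨x, hx⟩, 1)) =
      φ (y, 1) := fun y => dif_pos y.2
  refine ⟨U, fun y => if h : y ∈ U then φ (⟨y, h⟩, 1) else φ (⟨x, hx⟩, 1), hU, hx, ?_, ?_⟩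
  · rw [continuousOn_iff_continuous_domRestrict]
    have : Continuous fun y : U => (φ (y, 1) : E.total) := by fun_prop
    exact this.congr fun y => (hs y).symm
  · intro y hy
    simp only [dif_pos hy, h1]

theorem exists_proj_eq (x : X) : ∃ p, E.proj p = x := by
  obtain ⟨U, s, -, hx, -, hs⟩ := E.exists_local_section x
  exact ⟨s x, hs x hx⟩

end PrincipalBundle

/-! ### Orthonormal frames -/

section Frames

variable {X : Type u} [TopologicalSpace X] [ChartedSpace (EuclideanSpace ℝ (Fin 4)) X]
  [IsManifold (𝓡 4) ∞ X] {g : RiemannianMetric4 X} {o : Orientation4 X}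

namespace OrthoFrame

theorem vectors_injective : Function.Injective (vectors : OrthoFrame g o → _) := by
  rintro ⟨x, b, h1, h2⟩ ⟨y, b', h3, h4⟩ h
  obtain rfl : x = y := congrArg Bundle.TotalSpace.proj (congrFun h 0)
  obtain rfl : b = b' := Module.Basis.eq_of_apply_eq fun i => by
    have := congrFun h i
    exact eq_of_heq (Bundle.TotalSpace.mk.inj this).2
  rfl

theorem inner_act_basis (e : OrthoFrame g o) (A : Matrix.specialOrthogonalGroup (Fin 4) ℝ)
    (i j : Fin 4) : g.inner e.base (e.basis i) ((e.act A).basis j) =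
      (A : Matrix (Fin 4) (Fin 4) ℝ) i j := by
  rw [act_basis, map_sum]
  simp [e.orthonormal]

theorem act_injective (e : OrthoFrame g o) : Function.Injective e.act := by
  intro A B h
  apply Subtype.ext
  ext i j
  rw [← e.inner_act_basis A, ← e.inner_act_basis B]
  have hv : (e.act A).vectors j = (e.act B).vectors j := by rw [h]
  exact congrArg (g.inner e.base (e.basis i)) (eq_of_heq (Bundle.TotalSpace.mk.inj hv).2)

theorem exists_act_eq {e e' : OrthoFrame g o} (h : e.base = e'.base) : ∃ A, e.act A = e' := by
  obtain ⟨x, b, h1, h2⟩ := e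
  obtain ⟨y, b', h3, h4⟩ := e'
  obtain rfl : x = y := h
  have hsum : ∀ j, ∑ i, b.toMatrix b' i j • b i = b' j := fun j =>
    b.sum_toMatrix_smul_self b' j
  have horth : b.toMatrix b' ∈ Matrix.orthogonalGroup (Fin 4) ℝ := by
    rw [Matrix.mem_orthogonalGroup_iff']
    ext i j
    have h := h3 i j
    rw [← hsum i, ← hsum j] at h
    simp only [map_sum, map_smul, sum_apply, smul_apply,
      h1, smul_eq_mul, mul_ite, mul_one, mul_zero, Finset.sum_ite_eq',
      Finset.mem_univ, if_true] at h
    refine Matrix.mul_apply.trans (Eq.trans ?_ (h.trans Matrix.one_apply.symm))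
    exact Finset.sum_congr rfl fun k _ => mul_comm _ _
  have hpos : 0 < (b.toMatrix b').det :=
    (Module.Basis.orientation_eq_iff_det_pos b b').1 (h2.trans h4.symm)
  have hdet : (b.toMatrix b').det = 1 := by
    have h := congrArg Matrix.det ((Matrix.mem_orthogonalGroup_iff' (Fin 4) ℝ).1 horth)
    rw [Matrix.det_mul, Matrix.det_transpose, Matrix.det_one] at h
    nlinarith
  refine ⟨⟨b.toMatrix b', Matrix.mem_specialOrthogonalGroup_iff.2 ⟨horth, hdet⟩⟩, ?_⟩
  apply vectors_injective
  funext j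
  exact congrArg (fun v : TangentSpace (𝓡 4) x => (⟨x, v⟩ : TangentBundle (𝓡 4) X))
    ((act_basis _ _ j).trans (hsum j))

theorem continuous_vectors : Continuous (vectors : OrthoFrame g o → _) := continuous_induced_dom

/-- The matrix relating two orthonormal frames consists of their inner products, so it depends
continuously on them. -/
theorem continuousOn_of_act {Y : Type*} [TopologicalSpace Y] {s : Set Y}
    {e : Y → OrthoFrame g o} {A : Y → Matrix.specialOrthogonalGroup (Fin 4) ℝ}
    (he : ContinuousOn e s) (heA : ContinuousOn (fun y => (e y).act (A y)) s) :
    ContinuousOn A s := by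
  have hv : ∀ {f : Y → OrthoFrame g o}, ContinuousOn f s → ∀ i,
      ContinuousOn (fun y => (f y).vectors i) s := fun hf i =>
    ((continuous_apply i).comp continuous_vectors).comp_continuousOn hf
  have hbase : ContinuousOn (fun y => (e y).base) s :=
    (FiberBundle.continuous_proj (EuclideanSpace ℝ (Fin 4))
      (TangentSpace (𝓡 4) : X → Type _)).comp_continuousOn (hv he 0)
  have hij : ∀ i j, ContinuousOn (fun y => (A y : Matrix (Fin 4) (Fin 4) ℝ) i j) s := by
    intro i j
    have h := ContinuousOn.clm_bundle_apply₂ (F₁ := EuclideanSpace ℝ (Fin 4))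
      (F₂ := EuclideanSpace ℝ (Fin 4)) (F₃ := ℝ) (E₃ := Bundle.Trivial X ℝ)
      (E₁ := (TangentSpace (𝓡 4) : X → Type _)) (E₂ := (TangentSpace (𝓡 4) : X → Type _))
      (b := fun y => (e y).base) (ψ := fun y => g.inner (e y).base)
      (v := fun y => (e y).basis i) (w := fun y => ((e y).act (A y)).basis j)
      (g.contMDiff.continuous.comp_continuousOn hbase) (hv he i) (hv heA j)
    intro y hy
    have h' := h y hy
    rw [FiberBundle.continuousWithinAt_totalSpace] at h'
    refine h'.2.congr (fun z _ => ?_) ?_ <;> exact ((e _).inner_act_basis _ i j).symm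
  rw [continuousOn_iff_continuous_domRestrict]
  refine Continuous.subtype_mk (continuous_matrix fun i j => ?_) _
  exact continuousOn_iff_continuous_domRestrict.1 (hij i j)

end OrthoFrame

namespace IsometricInvolution

theorem frameMap_frameMap (c : IsometricInvolution g o) (e : OrthoFrame g o) :
    c.frameMap (c.frameMap e) = e := by
  have hc : MDifferentiable (𝓡 4) (𝓡 4) c.toDiffeo := c.toDiffeo.mdifferentiable (by simp)
  have hcc : (c.toDiffeo : X → X) ∘ c.toDiffeo = id := funext c.involutive
  apply OrthoFrame.vectors_injective
  funext i
  change tangentMap (𝓡 4) (𝓡 4) c.toDiffeo (tangentMap (𝓡 4) (𝓡 4) c.toDiffeo (e.vectors i)) = _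
  rw [← Function.comp_apply (f := tangentMap (𝓡 4) (𝓡 4) c.toDiffeo), ← tangentMap_comp hc hc, hcc,
    tangentMap_id]
  rfl

end IsometricInvolution

end Frames

/-! ### Antilinear lifts -/

theorem exists_eq_const_of_continuousOn_univ {X Y : Type*} [TopologicalSpace X] [ConnectedSpace X]
    [TopologicalSpace Y] [DiscreteTopology Y] {n : X → Y} (hn : ContinuousOn n Set.univ) :
    ∃ ε, ∀ x, n x = ε := by
  obtain ⟨x₀⟩ := (inferInstance : Nonempty X)
  exact ⟨n x₀, fun x => ((IsLocallyConstant.iff_continuous n).2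
    (continuousOn_univ.1 hn)).apply_eq_of_isPreconnected isPreconnected_univ trivial trivial⟩

namespace SpincStructure

variable {X : Type u} [TopologicalSpace X] [ChartedSpace (EuclideanSpace ℝ (Fin 4)) X]
  [IsManifold (𝓡 4) ∞ X] {g : RiemannianMetric4 X} {o : Orientation4 X}
  {S : SpincStructure.{u, v} g o} {c : IsometricInvolution g o}
  {cQ : RealInvolution S.detBundle c}

theorem continuous_toDet (S : SpincStructure.{u, v} g o) : Continuous S.toDet :=
  continuous_quotient_mk'.comp (by fun_prop)

theorem proj_toDet (S : SpincStructure.{u, v} g o) (p : S.total) :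
    S.detBundle.proj (S.toDet p) = S.proj p := rfl

theorem proj_eq_of_toFrame_eq {p q : S.total} (h : S.toFrame p = S.toFrame q) :
    S.proj p = S.proj q := by
  rw [← S.base_toFrame, h, S.base_toFrame]

@[simp] theorem toFrame_act_sign (p : S.total) (n : ZMod 2) :
    S.toFrame (S.act p (Spinc4.sign n)) = S.toFrame p := by
  have h : (Spinc4.sign n).toSO = Spinc4.toSO 1 :=
    (congrArg Prod.fst (Spinc4.toSODet_eq_one_iff.2 ⟨n, rfl⟩)).trans (map_one Spinc4.toSO).symm
  rw [S.toFrame_act, h, ← S.toFrame_act, S.act_one]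

@[simp] theorem toDet_act_sign (p : S.total) (n : ZMod 2) :
    S.toDet (S.act p (Spinc4.sign n)) = S.toDet p := by
  have h : (Spinc4.sign n).det = 1 :=
    congrArg Prod.snd (Spinc4.toSODet_eq_one_iff.2 ⟨n, rfl⟩)
  rw [S.act_toDet, h, S.detBundle.act_one]

/-- The map `𝔰 → P ×_X Q` is a double covering: its fibres are the orbits of `± 1`. -/
theorem exists_sign {p q : S.total} (h : S.toFrame p = S.toFrame q) (h' : S.toDet p = S.toDet q) :
    ∃ n, q = S.act p (Spinc4.sign n) := by
  obtain ⟨k, rfl⟩ := S.exists_act_eq (proj_eq_of_toFrame_eq h)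
  have h1 : k.toSO = 1 := by
    apply (S.toFrame p).act_injective
    rw [← S.toFrame_act, ← h, ← map_one Spinc4.toSO, ← S.toFrame_act, S.act_one]
  have h2 : k.det = 1 := by
    apply S.detBundle.act_injective (S.toDet p)
    rw [← S.act_toDet, ← h', S.detBundle.act_one]
  obtain ⟨n, rfl⟩ := Spinc4.toSODet_eq_one_iff.1 (show k.toSODet = 1 from Prod.ext h1 h2)
  exact ⟨n, rfl⟩

theorem sign_unique {p : S.total} {m n : ZMod 2}
    (h : S.act p (Spinc4.sign m) = S.act p (Spinc4.sign n)) : m = n :=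
  Spinc4.sign_injective (S.act_injective p h)

theorem continuousOn_sign {Y : Type*} [TopologicalSpace Y] {s : Set Y} {a b : Y → S.total}
    {n : Y → ZMod 2} (ha : ContinuousOn a s) (hb : ContinuousOn b s)
    (h : ∀ y ∈ s, a y = S.act (b y) (Spinc4.sign (n y))) : ContinuousOn n s := by
  rw [Spinc4.isClosedEmbedding_sign.isInducing.continuousOn_iff]
  refine (S.continuousOn_diff hb ha fun y hy => ?_).congr fun y hy => ?_
  · rw [h y hy, S.proj_act]
  · simp only [Function.comp_apply, h y hy, S.diff_act]

/-- Two maps of `𝔰` with the same equivariance which induce the same maps to `P` and `Q` differ by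
a locally constant sign on the base. -/
theorem exists_sign_function {U : Set X} (hU : IsOpen U) {a b : S.total → S.total}
    {σ : Spinc4 → Spinc4} (ha : ContinuousOn a (S.proj ⁻¹' U))
    (hb : ContinuousOn b (S.proj ⁻¹' U))
    (hframe : ∀ p, S.proj p ∈ U → S.toFrame (a p) = S.toFrame (b p))
    (hdet : ∀ p, S.proj p ∈ U → S.toDet (a p) = S.toDet (b p))
    (haσ : ∀ p, S.proj p ∈ U → ∀ k, a (S.act p k) = S.act (a p) (σ k))
    (hbσ : ∀ p, S.proj p ∈ U → ∀ k, b (S.act p k) = S.act (b p) (σ k)) :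
    ∃ n : X → ZMod 2, ContinuousOn n U ∧
      ∀ p, S.proj p ∈ U → a p = S.act (b p) (Spinc4.sign (n (S.proj p))) := by
  have h : ∀ x, ∃ n : ZMod 2, x ∈ U → ∀ p, S.proj p = x → a p = S.act (b p) (Spinc4.sign n) := by
    intro x
    by_cases hx : x ∈ U
    · obtain ⟨p, rfl⟩ := S.exists_proj_eq x
      obtain ⟨n, hn⟩ := exists_sign (hframe p hx).symm (hdet p hx).symm
      refine ⟨n, fun _ q hq => ?_⟩
      obtain ⟨k, rfl⟩ := S.exists_act_eq hq.symm
      rw [haσ p hx, hbσ p hx, hn, ← S.act_mul, ← S.act_mul, Spinc4.sign_mul_comm]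
    · exact ⟨0, fun h => absurd h hx⟩
  choose n hn using h
  refine ⟨n, fun x hx => ?_, fun p hp => hn _ hp p rfl⟩
  obtain ⟨V, s, hV, hxV, hs, hps⟩ := S.exists_local_section x
  have hmaps : Set.MapsTo s (U ∩ V) (S.proj ⁻¹' U) := fun y hy => by
    rw [Set.mem_preimage, hps y hy.2]
    exact hy.1
  have hs' := hs.mono (Set.inter_subset_right (s := U))
  have hcont : ContinuousOn n (U ∩ V) := continuousOn_sign (S := S)
    (ha.comp hs' hmaps) (hb.comp hs' hmaps) fun y hy => hn y hy.1 (s y) (hps y hy.2)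
  exact (hcont.continuousAt ((hU.inter hV).mem_nhds ⟨hx, hxV⟩)).continuousWithinAt

namespace IsRealLiftOn

theorem mono {U V : Set X} {f : S.total → S.total} (hf : S.IsRealLiftOn c cQ U f) (h : V ⊆ U) :
    S.IsRealLiftOn c cQ V f :=
  ⟨hf.1.mono (Set.preimage_mono h), fun p hp => hf.2 p (h hp)⟩

theorem proj_eq {U : Set X} {f : S.total → S.total} (hf : S.IsRealLiftOn c cQ U f) {p : S.total}
    (hp : S.proj p ∈ U) : S.proj (f p) = c (S.proj p) := by
  rw [← S.base_toFrame, (hf.2 p hp).1, ← S.base_toFrame]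
  rfl

theorem exists_sign_function {U : Set X} (hU : IsOpen U) {f f' : S.total → S.total}
    (hf : S.IsRealLiftOn c cQ U f) (hf' : S.IsRealLiftOn c cQ U f') :
    ∃ n : X → ZMod 2, ContinuousOn n U ∧
      ∀ p, S.proj p ∈ U → f p = S.act (f' p) (Spinc4.sign (n (S.proj p))) :=
  SpincStructure.exists_sign_function hU hf.1 hf'.1
    (fun p hp => (hf.2 p hp).1.trans (hf'.2 p hp).1.symm)
    (fun p hp => (hf.2 p hp).2.1.trans (hf'.2 p hp).2.1.symm)
    (fun p hp => (hf.2 p hp).2.2) (fun p hp => (hf'.2 p hp).2.2)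

theorem act_sign {U : Set X} {f : S.total → S.total} (hf : S.IsRealLiftOn c cQ U f)
    {n : X → ZMod 2} (hn : ContinuousOn n U) :
    S.IsRealLiftOn c cQ U fun p => S.act (f p) (Spinc4.sign (n (S.proj p))) := by
  refine ⟨?_, fun p hp => ⟨?_, ?_, fun k => ?_⟩⟩
  · refine S.continuous_act.comp_continuousOn (hf.1.prodMk ?_)
    exact Spinc4.isClosedEmbedding_sign.continuous.comp_continuousOn
      (hn.comp S.continuous_proj.continuousOn fun _ h => h)
  · rw [toFrame_act_sign, (hf.2 p hp).1]
  · rw [toDet_act_sign, (hf.2 p hp).2.1]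
  · beta_reduce
    rw [(hf.2 p hp).2.2, S.proj_act, ← S.act_mul, ← S.act_mul, Spinc4.sign_mul_comm]

end IsRealLiftOn

variable (c cQ) in
/-- Over a small open set a lift is determined by the image of a section of `𝔰`, which has to be a
lift of a section of `P ×_X Q` along the double covering `𝔰 → P ×_X Q`. -/
theorem exists_isRealLiftOn (x : X) :
    ∃ U f, IsOpen U ∧ x ∈ U ∧ S.IsRealLiftOn c cQ U f := by
  obtain ⟨U₁, s, hU₁, hx₁, hs, hps⟩ := S.exists_local_section x
  obtain ⟨V₁, t, hV₁, hx₂, ht, hpt⟩ := S.exists_local_section (c x)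
  let U := U₁ ∩ c ⁻¹' V₁
  have hU : IsOpen U := hU₁.inter (hV₁.preimage c.continuous)
  have hsU : ContinuousOn s U := hs.mono Set.inter_subset_left
  have htU : ContinuousOn (fun y => t (c y)) U :=
    ht.comp c.continuous.continuousOn fun y hy => hy.2
  have hA : ∀ y, ∃ A, y ∈ U →
      (S.toFrame (t (c y))).act A = c.frameMap (S.toFrame (s y)) := by
    intro y
    by_cases hy : y ∈ U
    · obtain ⟨A, hA⟩ := OrthoFrame.exists_act_eq (e := S.toFrame (t (c y)))
        (e' := c.frameMap (S.toFrame (s y))) (by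
          change _ = c (S.toFrame (s y)).base
          rw [S.base_toFrame, S.base_toFrame, hpt _ hy.2, hps _ hy.1])
      exact ⟨A, fun _ => hA⟩
    · exact ⟨1, fun h => absurd h hy⟩
  choose A hA using hA
  have hAc : ContinuousOn A U := by
    refine OrthoFrame.continuousOn_of_act (e := fun y => S.toFrame (t (c y)))
      (S.continuous_toFrame.comp_continuousOn htU) ?_
    exact ((c.continuous_frameMap.comp S.continuous_toFrame).comp_continuousOn hsU).congr
      fun y hy => hA y hy
  have hproj : ∀ y ∈ U, S.detBundle.proj (S.toDet (t (c y))) =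
      S.detBundle.proj (cQ.toFun (S.toDet (s y))) := fun y hy => by
    rw [cQ.proj_toFun, proj_toDet, proj_toDet, hpt _ hy.2, hps _ hy.1]
  let w : X → Circle := fun y => S.detBundle.diff (S.toDet (t (c y))) (cQ.toFun (S.toDet (s y)))
  have hw : ContinuousOn w U := S.detBundle.continuousOn_diff
    (S.continuous_toDet.comp_continuousOn htU)
    ((cQ.continuous_toFun.comp S.continuous_toDet).comp_continuousOn hsU) hproj
  obtain ⟨V, hVU, hV, hxV, k, hk, hkh⟩ :=
    Spinc4.exists_local_lift hU (hAc.prodMk hw) (show x ∈ U from ⟨hx₁, hx₂⟩)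
  let d : S.total → Spinc4 := fun p => S.diff (s (S.proj p)) p
  have hd : ∀ p, S.proj p ∈ V → S.act (s (S.proj p)) (d p) = p := fun p hp =>
    S.act_diff (hps _ (hVU hp).1)
  have hVm : Set.MapsTo S.proj (S.proj ⁻¹' V) V := fun _ h => h
  have hpc := S.continuous_proj.continuousOn (s := S.proj ⁻¹' V)
  refine ⟨V, fun p => S.act (S.act (t (c (S.proj p))) (k (S.proj p))) (d p).conj, hV, hxV,
    ?_, fun p hp => ⟨?_, ?_, fun l => ?_⟩⟩
  · refine S.continuous_act.comp_continuousOn (ContinuousOn.prodMk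
      (S.continuous_act.comp_continuousOn (ContinuousOn.prodMk ?_ ?_))
      (Spinc4.continuous_conj.comp_continuousOn ?_))
    · exact (htU.mono hVU).comp hpc hVm
    · exact hk.comp hpc hVm
    · exact S.continuousOn_diff ((hsU.mono hVU).comp hpc hVm) continuousOn_id
        fun p hp => hps _ (hVU hp).1
  · have hkA : (k (S.proj p)).toSO = A (S.proj p) := congrArg Prod.fst (hkh _ hp)
    conv_rhs => rw [← hd p hp]
    rw [S.toFrame_act, S.toFrame_act, hkA, Spinc4.toSO_conj, hA _ (hVU hp), S.toFrame_act,
      c.frameMap_act]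
  · have hkw : (k (S.proj p)).det = w (S.proj p) := congrArg Prod.snd (hkh _ hp)
    conv_rhs => rw [← hd p hp]
    rw [S.act_toDet, S.act_toDet, hkw, S.act_toDet, cQ.antilinear,
      S.detBundle.act_diff (hproj _ (hVU hp)), Spinc4.det_conj]
  · simp only [d, S.proj_act]
    rw [S.diff_act_right (hps _ (hVU hp).1), map_mul, S.act_mul]

/-- Lifts over the members of an open cover which agree on the overlaps glue to a global lift. -/
theorem glue_mem_realLifts {U : X → Set X} (hU : ∀ x, IsOpen (U x)) (hmem : ∀ x, x ∈ U x)
    {f : X → S.total → S.total} (hf : ∀ x, S.IsRealLiftOn c cQ (U x) (f x))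
    (heq : ∀ x y p, S.proj p ∈ U x → S.proj p ∈ U y → f x p = f y p) :
    (fun p => f (S.proj p) p) ∈ S.realLifts c cQ := by
  refine ⟨fun p _ => ?_, fun p _ => ?_⟩
  · have hV : IsOpen (S.proj ⁻¹' U (S.proj p)) := (hU _).preimage S.continuous_proj
    have h : ContinuousOn (fun q => f (S.proj q) q) (S.proj ⁻¹' U (S.proj p)) :=
      (hf (S.proj p)).1.congr fun q hq => heq _ _ q (hmem _) hq
    exact (h.continuousAt (hV.mem_nhds (hmem _))).continuousWithinAt
  · obtain ⟨h1, h2, h3⟩ := (hf (S.proj p)).2 p (hmem _)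
    refine ⟨h1, h2, fun k => ?_⟩
    simp only [S.proj_act]
    exact h3 k

section Square

variable [ConnectedSpace X]

/-- The square of a global lift covers `dc² = 1` and `c_Q² = 1`, and it is equivariant since
conjugation is an involution. -/
theorem exists_sign_sq {f : S.total → S.total} (hf : f ∈ S.realLifts c cQ) :
    ∃ ε, ∀ p, f (f p) = S.act p (Spinc4.sign ε) := by
  have h := fun p => hf.2 p (Set.mem_univ _)
  have hc : Continuous f := continuousOn_univ.1 hf.1
  obtain ⟨n, hn, hfn⟩ := exists_sign_function (S := S) (a := f ∘ f) (b := id) (σ := id)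
    isOpen_univ (hc.comp hc).continuousOn continuousOn_id
    (fun p _ => by
      rw [Function.comp_apply, (h _).1, (h p).1, c.frameMap_frameMap, id])
    (fun p _ => by
      rw [Function.comp_apply, (h _).2.1, (h p).2.1, cQ.involutive, id])
    (fun p _ k => by
      rw [Function.comp_apply, (h p).2.2, (h _).2.2, Spinc4.conj_conj]
      rfl)
    (fun p _ k => rfl)
  obtain ⟨ε, hε⟩ := exists_eq_const_of_continuousOn_univ hn
  exact ⟨ε, fun p => by rw [← hε (S.proj p)]; exact hfn p trivial⟩

/-- Two global lifts differ by a constant sign, which is central and fixed by conjugation, so it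
cancels in the square. -/
theorem sq_eq_sq {f f' : S.total → S.total} (hf : f ∈ S.realLifts c cQ)
    (hf' : f' ∈ S.realLifts c cQ) (p : S.total) : f' (f' p) = f (f p) := by
  obtain ⟨n, hn, h⟩ := IsRealLiftOn.exists_sign_function isOpen_univ hf' hf
  obtain ⟨ε, hε⟩ := exists_eq_const_of_continuousOn_univ hn
  have h' : ∀ q, f' q = S.act (f q) (Spinc4.sign ε) := fun q => by
    rw [h q trivial, hε]
  rw [h', h', (hf.2 _ trivial).2.2, Spinc4.conj_sign, ← S.act_mul, ← Spinc4.sign_add,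
    CharTwo.add_self_eq_zero, Spinc4.sign_zero, S.act_one]

theorem existsUnique_sign_sq (h : (S.realLifts c cQ).Nonempty) :
    ∃! ε : ZMod 2, ∀ f ∈ S.realLifts c cQ, ∀ p, f (f p) = S.act p (Spinc4.sign ε) := by
  obtain ⟨f, hf⟩ := h
  obtain ⟨ε, hε⟩ := exists_sign_sq hf
  refine ⟨ε, fun f' hf' p => (sq_eq_sq hf hf' p).trans (hε p), fun ε' hε' => ?_⟩
  obtain ⟨x⟩ := (inferInstance : Nonempty X)
  obtain ⟨p, -⟩ := S.exists_proj_eq x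
  exact sign_unique ((hε' f hf p).symm.trans (hε p))

/-- A global lift `f` is a homeomorphism, with inverse `± f`, so it is an isomorphism
`-𝔰 → c^*𝔰`; conversely such an isomorphism is a global lift. -/
theorem realLifts_nonempty_iff : (S.realLifts c cQ).Nonempty ↔ S.PullbackEqNeg c cQ := by
  constructor
  · rintro ⟨f, hf⟩
    have h := fun p => hf.2 p (Set.mem_univ _)
    have hc : Continuous f := continuousOn_univ.1 hf.1
    have hproj : ∀ p, S.proj (f p) = c (S.proj p) := fun p => IsRealLiftOn.proj_eq hf trivial
    obtain ⟨ε, hε⟩ := exists_sign_sq hf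
    have hεl : ∀ p, S.act (f (f p)) (Spinc4.sign ε) = p := fun p => by
      rw [hε, ← S.act_mul, ← Spinc4.sign_add, CharTwo.add_self_eq_zero, Spinc4.sign_zero,
        S.act_one]
    have hεr : ∀ p, f (S.act (f p) (Spinc4.sign ε)) = p := fun p => by
      rw [(h _).2.2, Spinc4.conj_sign, hεl]
    let Φ : S.neg.total ≃ₜ (S.pullback c).total :=
      { toFun := fun p => ⟨(S.proj p, f p), hproj p⟩
        invFun := fun a => S.act (f a.1.2) (Spinc4.sign ε)
        left_inv := hεl
        right_inv := fun a => by
          apply Subtype.ext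
          refine Prod.ext ?_ (hεr _)
          change S.proj (S.act (f a.1.2) (Spinc4.sign ε)) = a.1.1
          rw [S.proj_act, hproj, a.2]
          exact c.involutive _
        continuous_toFun := Continuous.subtype_mk (S.continuous_proj.prodMk hc) _
        continuous_invFun := S.continuous_act.comp
          ((hc.comp (continuous_snd.comp continuous_subtype_val)).prodMk continuous_const) }
    refine ⟨⟨Φ, fun p k => ?_, fun p => ?_⟩, fun p => (h p).2.1⟩
    · apply Subtype.ext
      refine Prod.ext (S.proj_act p _) ?_
      change f (S.act p k.conj) = S.act (f p) k
      rw [(h p).2.2, Spinc4.conj_conj]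
    · change c.frameMap (S.toFrame (f p)) = S.toFrame p
      rw [(h p).1, c.frameMap_frameMap]
  · rintro ⟨Φ, hΦ⟩
    refine ⟨fun p => (Φ.toHomeomorph p).1.2, Continuous.continuousOn ?_, fun p _ =>
      ⟨?_, hΦ p, fun k => ?_⟩⟩
    · exact (continuous_snd.comp continuous_subtype_val).comp Φ.toHomeomorph.continuous
    · have h : c.frameMap (S.toFrame (Φ.toHomeomorph p).1.2) = S.toFrame p := Φ.map_toFrame p
      rw [← h, c.frameMap_frameMap]
    · have h := Φ.map_act p k.conj
      have e : S.neg.act p k.conj = S.act p k := congrArg (S.act p) (Spinc4.conj_conj k)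
      exact congrArg (fun a => a.1.2) ((congrArg Φ.toHomeomorph e).symm.trans h)

end Square

end SpincStructure

/-! ### Čech cohomology of the constant sheaf `ℤ/2` -/

section Cech

open TopologicalSpace

variable {X : Type u} [TopologicalSpace X]

namespace PointedCover

/-- The common refinement of two covers. -/
def inf (U V : PointedCover X) : PointedCover X where
  nhd x := U.nhd x ⊓ V.nhd x
  mem_nhd x := ⟨U.mem_nhd x, V.mem_nhd x⟩

theorem le_inf_left (U V : PointedCover X) : U ≤ U.inf V := fun _ => inf_le_left

theorem le_inf_right (U V : PointedCover X) : V ≤ U.inf V := fun _ => inf_le_right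

instance : IsDirectedOrder (PointedCover X) :=
  ⟨fun U V => ⟨U.inf V, U.le_inf_left V, U.le_inf_right V⟩⟩

instance : DirectedSystem (fun U : PointedCover X => U.H1)
    (fun U V h => restrictH1 U V h) where
  map_self U a := by
    induction a using QuotientAddGroup.induction_on
    rfl
  map_map U V W h h' a := by
    induction a using QuotientAddGroup.induction_on
    rfl

/-- A family of continuous functions on the overlaps, as a cochain. -/
def C1.ofContinuousOn (U : PointedCover X) (n : X → X → X → ZMod 2)
    (hn : ∀ x y, ContinuousOn (n x y) (U.nhd x ⊓ U.nhd y : Opens X)) : U.C1 := fun x y =>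
  ⟨fun z => n x y z, (IsLocallyConstant.iff_continuous _).2
    (continuousOn_iff_continuous_domRestrict.1 (hn x y))⟩

/-- A family of continuous functions on the members of a cover, as a cochain. -/
def C0.ofContinuousOn (U : PointedCover X) (n : X → X → ZMod 2)
    (hn : ∀ x, ContinuousOn (n x) (U.nhd x)) : U.C0 := fun x =>
  ⟨fun z => n x z, (IsLocallyConstant.iff_continuous _).2
    (continuousOn_iff_continuous_domRestrict.1 (hn x))⟩

theorem d0_apply (U : PointedCover X) (b : U.C0) {x y z : X} (hx : z ∈ U.nhd x)
    (hy : z ∈ U.nhd y) : (U.d0 b).1 x y ⟨z, hx, hy⟩ = b y ⟨z, hy⟩ - b x ⟨z, hx⟩ := rfl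

theorem restrictZ1_apply {U V : PointedCover X} (h : U ≤ V) (a : U.Z1) {x y z : X}
    (hx : z ∈ V.nhd x) (hy : z ∈ V.nhd y) :
    (restrictZ1 h a).1 x y ⟨z, hx, hy⟩ = a.1 x y ⟨z, h x hx, h y hy⟩ := rfl

end PointedCover

namespace CechH1

theorem mk_restrictZ1 {U V : PointedCover X} (h : U ≤ V) (a : U.Z1) :
    mk (PointedCover.restrictZ1 h a) = mk a := by
  classical
  exact AddCommGroup.DirectLimit.of_f (G := fun U : PointedCover X => U.H1)
    (f := PointedCover.restrictH1) h (QuotientAddGroup.mk a)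

theorem mk_zero (U : PointedCover X) : mk (0 : U.Z1) = 0 := by
  classical
  exact map_zero (AddCommGroup.DirectLimit.of (fun U : PointedCover X => U.H1)
    PointedCover.restrictH1 U)

theorem mk_eq_of_sub_eq_d0 {U : PointedCover X} {a a' : U.Z1} {b : U.C0} (h : a' - a = U.d0 b) :
    mk a = mk a' := by
  have : (QuotientAddGroup.mk a : U.H1) = QuotientAddGroup.mk a' :=
    QuotientAddGroup.eq.2 ⟨b, by rw [← h, sub_eq_neg_add]⟩
  rw [mk, this, mk]

theorem exists_restrictZ1_eq_d0 {U : PointedCover X} {a : U.Z1} (h : mk a = 0) :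
    ∃ (V : PointedCover X) (hUV : U ≤ V) (b : V.C0), PointedCover.restrictZ1 hUV a = V.d0 b := by
  classical
  obtain ⟨V, hUV, hV⟩ := AddCommGroup.DirectLimit.of.zero_exact
    (G := fun U : PointedCover X => U.H1) (f := PointedCover.restrictH1) U _ h
  obtain ⟨b, hb⟩ := (QuotientAddGroup.eq_zero_iff (PointedCover.restrictZ1 hUV a)).1 hV
  exact ⟨V, hUV, b, hb.symm⟩

end CechH1

end Cech

/-! ### The obstruction class -/

namespace SpincStructure

variable {X : Type u} [TopologicalSpace X] [ChartedSpace (EuclideanSpace ℝ (Fin 4)) X]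
  [IsManifold (𝓡 4) ∞ X] {g : RiemannianMetric4 X} {o : Orientation4 X}
  {S : SpincStructure.{u, v} g o} {c : IsometricInvolution g o}
  {cQ : RealInvolution S.detBundle c}

variable (S c cQ) in
theorem exists_isRealObstruction : ∃ μ, S.IsRealObstruction c cQ μ := by
  choose U f hU hmem hf using exists_isRealLiftOn (S := S) c cQ
  let 𝓤 : PointedCover X := ⟨fun x => ⟨U x, hU x⟩, hmem⟩
  have h : ∀ x y, ∃ n : X → ZMod 2, ContinuousOn n (U x ∩ U y) ∧
      ∀ p, S.proj p ∈ U x ∩ U y → f x p = S.act (f y p) (Spinc4.sign (n (S.proj p))) := fun x y =>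
    IsRealLiftOn.exists_sign_function ((hU x).inter (hU y)) ((hf x).mono Set.inter_subset_left)
      ((hf y).mono Set.inter_subset_right)
  choose n hn hnf using h
  refine ⟨_, 𝓤, ⟨.ofContinuousOn 𝓤 n hn, ?_⟩, f, hf, fun x y p hx hy => hnf x y p ⟨hx, hy⟩, rfl⟩
  intro x y w z hx hy hw
  obtain ⟨p, rfl⟩ := S.exists_proj_eq z
  apply sign_unique (p := f w p)
  change S.act (f w p) (Spinc4.sign (n x y _ + n y w _)) = S.act (f w p) (Spinc4.sign (n x w _))
  rw [add_comm, Spinc4.sign_add, S.act_mul, ← hnf y w p ⟨hy, hw⟩, ← hnf x y p ⟨hx, hy⟩,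
    ← hnf x w p ⟨hx, hw⟩]

/-- On a common refinement of the two covers, two families of local lifts differ by signs, and these
form a cochain whose differential is the difference of the two cocycles. -/
theorem IsRealObstruction.eq {μ μ' : CechH1 X} (h : S.IsRealObstruction c cQ μ)
    (h' : S.IsRealObstruction c cQ μ') : μ = μ' := by
  obtain ⟨U, a, f, hf, haf, rfl⟩ := h
  obtain ⟨U', a', f', hf', haf', rfl⟩ := h'
  let V := U.inf U'
  have hn : ∀ x, ∃ n : X → ZMod 2, ContinuousOn n (V.nhd x) ∧
      ∀ p, S.proj p ∈ V.nhd x → f x p = S.act (f' x p) (Spinc4.sign (n (S.proj p))) := fun x =>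
    IsRealLiftOn.exists_sign_function (V.nhd x).isOpen ((hf x).mono fun _ hz => hz.1)
      ((hf' x).mono fun _ hz => hz.2)
  choose n hn hnf using hn
  rw [← CechH1.mk_restrictZ1 (U.le_inf_left U') a, ← CechH1.mk_restrictZ1 (U.le_inf_right U') a']
  refine CechH1.mk_eq_of_sub_eq_d0 (b := .ofContinuousOn V n hn) ?_
  apply Subtype.ext
  funext x y
  ext ⟨z, hx, hy⟩
  obtain ⟨p, rfl⟩ := S.exists_proj_eq z
  change a'.1 x y ⟨S.proj p, hx.2, hy.2⟩ - a.1 x y ⟨S.proj p, hx.1, hy.1⟩ =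
    n y (S.proj p) - n x (S.proj p)
  have e : n x (S.proj p) + a'.1 x y ⟨S.proj p, hx.2, hy.2⟩ =
      a.1 x y ⟨S.proj p, hx.1, hy.1⟩ + n y (S.proj p) := by
    apply sign_unique (p := f' y p)
    rw [add_comm, Spinc4.sign_add, S.act_mul, ← haf' x y p hx.2 hy.2, ← hnf x p hx,
      haf x y p hx.1 hy.1, hnf y p hy, ← S.act_mul, ← Spinc4.sign_add, add_comm]
  rw [CharTwo.sub_eq_add, CharTwo.sub_eq_add]
  have h2 := CharTwo.add_self_eq_zero (n x (S.proj p))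
  have h3 := CharTwo.add_self_eq_zero (a.1 x y ⟨S.proj p, hx.1, hy.1⟩)
  linear_combination e + h3 - h2

/-- If the cocycle of signs is, on a refinement, the differential of a cochain, multiplying the
local lifts by the signs of that cochain makes them agree on the overlaps. -/
theorem isRealObstruction_zero_iff :
    S.IsRealObstruction c cQ 0 ↔ (S.realLifts c cQ).Nonempty := by
  constructor
  · rintro ⟨U, a, f, hf, haf, ha⟩
    obtain ⟨V, hUV, b, hb⟩ := CechH1.exists_restrictZ1_eq_d0 ha
    classical
    -- `b x`, extended by zero
    let n : X → X → ZMod 2 := fun x z => if h : z ∈ V.nhd x then b x ⟨z, h⟩ else 0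
    have hnb : ∀ x (z : V.nhd x), n x z = b x z := fun x z => dif_pos z.2
    have hn : ∀ x, ContinuousOn (n x) (V.nhd x) := fun x =>
      continuousOn_iff_continuous_domRestrict.2 ((b x).continuous.congr fun z => (hnb x z).symm)
    refine ⟨_, glue_mem_realLifts (fun x => (V.nhd x).isOpen) V.mem_nhd
      (fun x => ((hf x).mono (hUV x)).act_sign (hn x)) fun x y p hx hy => ?_⟩
    have hab : a.1 x y ⟨S.proj p, hUV x hx, hUV y hy⟩ = n y (S.proj p) - n x (S.proj p) := by
      rw [← PointedCover.restrictZ1_apply hUV a hx hy, hb, PointedCover.d0_apply V b hx hy,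
        ← hnb y ⟨_, hy⟩, ← hnb x ⟨_, hx⟩]
    rw [haf x y p (hUV x hx) (hUV y hy), hab, ← S.act_mul, ← Spinc4.sign_add, sub_add_cancel]
  · rintro ⟨f, hf⟩
    refine ⟨⟨fun _ => ⊤, fun _ => trivial⟩, 0, fun _ => f, fun _ => hf, fun x y p _ _ => ?_,
      CechH1.mk_zero _⟩
    exact (S.act_one _).symm

theorem IsRealObstruction.eq_zero_iff {μ : CechH1 X} (h : S.IsRealObstruction c cQ μ) :
    μ = 0 ↔ (S.realLifts c cQ).Nonempty := by
  rw [← isRealObstruction_zero_iff]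
  exact ⟨fun h0 => h0 ▸ h, fun h0 => h.eq h0⟩

end SpincStructure

theorem mainTheorem8 {X : Type u} [TopologicalSpace X] [T2Space X]
    [SecondCountableTopology X] [ConnectedSpace X]
    [ChartedSpace (EuclideanSpace ℝ (Fin 4)) X] [IsManifold (𝓡 4) ∞ X]
    (g : RiemannianMetric4 X) (o : Orientation4 X) (c : IsometricInvolution g o)
    (S : SpincStructure.{u, v} g o) (cQ : RealInvolution S.detBundle c) :
    (∃! μ : CechH1 X, S.IsRealObstruction c cQ μ) ∧
    ∀ μ : CechH1 X, S.IsRealObstruction c cQ μ →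
      (μ = 0 ↔ S.PullbackEqNeg c cQ) ∧
      (μ = 0 → (S.realLifts c cQ).Nonempty ∧
        ∃! ε : ZMod 2, ∀ f ∈ S.realLifts c cQ, ∀ p, f (f p) = S.act p (Spinc4.sign ε)) := by
  obtain ⟨μ, hμ⟩ := S.exists_isRealObstruction c cQ
  refine ⟨⟨μ, hμ, fun μ' hμ' => hμ'.eq hμ⟩, fun μ hμ => ⟨?_, fun h0 => ?_⟩⟩
  · rw [hμ.eq_zero_iff, SpincStructure.realLifts_nonempty_iff]
  · have hne := hμ.eq_zero_iff.1 h0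
    exact ⟨hne, SpincStructure.existsUnique_sign_sq hne⟩
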